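/- Let $G=(V,E)$ be a finite simple graph and let $D=(E,A)$ be a digraph whose vertices are the edges of $G$. For $e\in E$ let $\mathrm{dep}(e)=\{e'\in E:(e',e)\in A\}$, and for $X\subseteq E$ let $\mathrm{dep}(X)=\bigcup_{e\in X}\mathrm{dep}(e)$. For functions $\ell,u:E\to\mathbb N$, the problem G-DCST$(G,D,\ell,u)$ asks whether $G$ has a spanning tree $T$ with $\ell(e)\le|\mathrm{dep}(e)\cap E(T)|\le u(e)$ for every $e\in E(T)$; it is called feasible if such a $T$ exists. Theorem. Consider the instances in which every weakly connected component of $D$ is a directed path of length at most $1$ (a single vertex, or two vertices joined by exactly one arc) and $\ell(e)=u(e)=|\mathrm{dep}(e)|\in\{0,1\}$ for every $e\in E$. (1) On these instances, G-DCST can be solved in polynomial time: there is a program for a unit-cost random access machine (with addition and truncated subtraction, but no multiplication) which, given lists of the edges of $G$ by their ends and of the arcs of $D$, decides G-DCST$(G,D,\ell,u)$ in a number of steps bounded by a polynomial in $|V|+|E|+|A|$. (2) For each such instance let $S=\{e\in E:\mathrm{dep}(e)\neq\emptyset\}$, let $k$ be the number of connected components of $G-S=(V,E\setminus S)$, and let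 $H$ be the multigraph obtained from $G$ by contracting each connected component of $G-S$ to a single vertex, where an edge of $S$ with both ends in the same component becomes a loop. Then the sets $X\subseteq S$ such that $(V,\mathrm{dep}(X))$ is acyclic are the independent sets of a graphic matroid $M_1$ on $S$ (that of the graph $(V,\mathrm{dep}(S))$, with $e\in S$ identified with the unique member of $\mathrm{dep}(e)$); the sets $X\subseteq S$ that contain no cycle of $H$ (loops count as cycles) are the independent sets of a graphic matroid $M_2$ on $S$; and G-DCST$(G,D,\ell,u)$ is feasible if and only if there is a set of size $k-1$ that is independent in both $M_1$ and $M_2$. -/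

import Mathlib

namespace DCST

/-! ### Polynomial time: programs on a random access machine with unit cost -/

/-- The store of a random access machine: registers and arrays, all holding natural numbers. -/
structure Store where
  reg : ℕ → ℕ
  arr : ℕ → ℕ → ℕ

/-- `x := v`. -/
def Store.setReg (s : Store) (x v : ℕ) : Store where
  reg := Function.update s.reg x v
  arr := s.arr

/-- `a[i] := v`. -/
def Store.setArr (s : Store) (a i v : ℕ) : Store where
  reg := s.reg
  arr := Function.update s.arr a (Function.update (s.arr a) i v)

/-- Programs. A program names finitely many registers and arrays. The only arithmetic operations
are addition and truncated subtraction (no multiplication), so that `t` steps produce numbers of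
`O(t)` more bits than the input has: unit cost is polynomially equivalent to Turing machine
time. -/
inductive Prog where
  /-- do nothing -/
  | skip
  /-- `reg x := c` -/
  | const (x c : ℕ)
  /-- `reg x := reg y + reg z` -/
  | add (x y z : ℕ)
  /-- `reg x := reg y - reg z` (truncated at zero) -/
  | sub (x y z : ℕ)
  /-- `reg x := arr a [reg y]` -/
  | load (x a y : ℕ)
  /-- `arr a [reg x] := reg y` -/
  | store (a x y : ℕ)
  /-- `p; q` -/
  | seq (p q : Prog)
  /-- `if reg x < reg y then p else q` -/
  | ite (x y : ℕ) (p q : Prog)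
  /-- `while reg x < reg y do p` -/
  | loop (x y : ℕ) (p : Prog)

/-- `Exec p s s' t`: the program `p`, started in the store `s`, halts in the store `s'` after
exactly `t` steps. Each elementary instruction and each evaluation of a test is one step. -/
inductive Exec : Prog → Store → Store → ℕ → Prop where
  | skip (s : Store) : Exec .skip s s 1
  | const (s : Store) (x c : ℕ) : Exec (.const x c) s (s.setReg x c) 1
  | add (s : Store) (x y z : ℕ) : Exec (.add x y z) s (s.setReg x (s.reg y + s.reg z)) 1
  | sub (s : Store) (x y z : ℕ) : Exec (.sub x y z) s (s.setReg x (s.reg y - s.reg z)) 1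
  | load (s : Store) (x a y : ℕ) : Exec (.load x a y) s (s.setReg x (s.arr a (s.reg y))) 1
  | store (s : Store) (a x y : ℕ) : Exec (.store a x y) s (s.setArr a (s.reg x) (s.reg y)) 1
  | seq {p q : Prog} {s s' s'' : Store} {t t' : ℕ} :
      Exec p s s' t → Exec q s' s'' t' → Exec (.seq p q) s s'' (t + t')
  | iteTrue {x y : ℕ} {p q : Prog} {s s' : Store} {t : ℕ} :
      s.reg x < s.reg y → Exec p s s' t → Exec (.ite x y p q) s s' (t + 1)
  | iteFalse {x y : ℕ} {p q : Prog} {s s' : Store} {t : ℕ} :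
      ¬ s.reg x < s.reg y → Exec q s s' t → Exec (.ite x y p q) s s' (t + 1)
  | loopDone {x y : ℕ} {p : Prog} {s : Store} :
      ¬ s.reg x < s.reg y → Exec (.loop x y p) s s 1
  | loopStep {x y : ℕ} {p : Prog} {s s' s'' : Store} {t t' : ℕ} :
      s.reg x < s.reg y → Exec p s s' t → Exec (.loop x y p) s' s'' t' →
        Exec (.loop x y p) s s'' (t + t' + 1)

/-- Execution is deterministic: both the final store and the number of steps are determined by
the program and the initial store. -/
theorem Exec.deterministic {p : Prog} {s s₁ s₂ : Store} {t₁ t₂ : ℕ}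
    (h₁ : Exec p s s₁ t₁) (h₂ : Exec p s s₂ t₂) : s₁ = s₂ ∧ t₁ = t₂ := by
  induction h₁ generalizing s₂ t₂ with
  | seq _ _ ih ih' =>
    cases h₂ with
    | seq a b =>
      obtain ⟨rfl, rfl⟩ := ih a
      obtain ⟨rfl, rfl⟩ := ih' b
      exact ⟨rfl, rfl⟩
  | iteTrue h _ ih =>
    cases h₂ with
    | iteTrue _ a => obtain ⟨rfl, rfl⟩ := ih a; exact ⟨rfl, rfl⟩
    | iteFalse h' _ => exact absurd h h'
  | iteFalse h _ ih =>
    cases h₂ with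
    | iteTrue h' _ => exact absurd h' h
    | iteFalse _ a => obtain ⟨rfl, rfl⟩ := ih a; exact ⟨rfl, rfl⟩
  | loopDone h =>
    cases h₂ with
    | loopDone _ => exact ⟨rfl, rfl⟩
    | loopStep h' _ _ => exact absurd h' h
  | loopStep h _ _ ih ih' =>
    cases h₂ with
    | loopDone h' => exact absurd h h'
    | loopStep _ a b =>
      obtain ⟨rfl, rfl⟩ := ih a
      obtain ⟨rfl, rfl⟩ := ih' b
      exact ⟨rfl, rfl⟩
  | _ => cases h₂; exact ⟨rfl, rfl⟩

/-- A decision problem, with instances `i : ι` of size `size i` that are presented to the machine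
as the initial store `input i`, is solvable in polynomial time: one program halts on every
instance after a number of steps polynomial in the size, and ends with a nonzero number in
register `0` exactly on the yes-instances. -/
def SolvableInPolyTime {ι : Type} (input : ι → Store) (size : ι → ℕ) (yes : ι → Prop) : Prop :=
  ∃ (P : Prog) (b : Polynomial ℕ), ∀ i : ι, ∃ (s : Store) (t : ℕ),
    Exec P (input i) s t ∧ t ≤ b.eval (size i) ∧ (s.reg 0 ≠ 0 ↔ yes i)

/-! ### Dependency constrained spanning trees -/

section Problem

variable {V : Type*} {G : SimpleGraph V}

/-- The dependencies of an edge: its in-neighbours in `D`. -/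
def dep (D : Digraph G.edgeSet) (e : G.edgeSet) : Set G.edgeSet :=
  {e' | D.Adj e' e}

/-- The union of the dependency sets of the members of a set of edges. -/
def depSet (D : Digraph G.edgeSet) (X : Set G.edgeSet) : Set G.edgeSet :=
  ⋃ e ∈ X, dep D e

/-- `T` `(ℓ, u)`-satisfies `D`. -/
def Satisfies (D : Digraph G.edgeSet) (ℓ u : G.edgeSet → ℕ) (T : SimpleGraph V) : Prop :=
  ∀ e : G.edgeSet, (e : Sym2 V) ∈ T.edgeSet →
    ℓ e ≤ (dep D e ∩ {e' | (e' : Sym2 V) ∈ T.edgeSet}).ncard ∧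
      (dep D e ∩ {e' | (e' : Sym2 V) ∈ T.edgeSet}).ncard ≤ u e

/-- The problem G-DCST: is there a spanning tree of `G` that `(ℓ, u)`-satisfies `D`? -/
def GDCST (D : Digraph G.edgeSet) (ℓ u : G.edgeSet → ℕ) : Prop :=
  ∃ T : SimpleGraph V, T ≤ G ∧ T.IsTree ∧ Satisfies D ℓ u T

/-- Every (weakly) connected component of `D` is a directed path of length at most one: a single
vertex without a loop, or two vertices joined by exactly one arc. -/
def ComponentsArePathsOfLengthLEOne {E : Type*} (D : Digraph E) : Prop :=
  ∀ c : D.toSimpleGraphInclusive.ConnectedComponent,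
    (∃ e, c.supp = {e} ∧ ¬ D.Adj e e) ∨
      ∃ e f, e ≠ f ∧ c.supp = {e, f} ∧
        ∀ a ∈ c.supp, ∀ b ∈ c.supp, (D.Adj a b ↔ a = e ∧ b = f)

/-- The set `S` of the edges that have a dependency. -/
def dependentEdges (D : Digraph G.edgeSet) : Set G.edgeSet :=
  {e | (dep D e).Nonempty}

/-- The graph `G - S`. -/
def baseGraph (D : Digraph G.edgeSet) : SimpleGraph V :=
  G.deleteEdges (Subtype.val '' dependentEdges D)

/-- The ends of an edge in the multigraph `H` that is obtained from `G` by contracting each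
connected component of `G - S` to a vertex. -/
def contractedEnds (D : Digraph G.edgeSet) (e : G.edgeSet) :
    Sym2 (baseGraph D).ConnectedComponent :=
  Sym2.map (baseGraph D).connectedComponentMk e

end Problem

/-- In the multigraph with vertex set `W` in which the edge `e` has the ends `ends e` (loops and
parallel edges are allowed), the set `X` of edges contains no cycle: no edge of `X` has its two
ends joined by a walk along the other edges of `X`. -/
def IsForest {α W : Type*} (ends : α → Sym2 W) (X : Set α) : Prop :=
  ∀ e ∈ X, ∀ x y : W, ends e = s(x, y) →
    ¬ (SimpleGraph.fromEdgeSet (ends '' (X \ {e}))).Reachable x y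

/-- `M` is the graphic matroid, on its ground set, of the multigraph with the ends `ends`. -/
def IsGraphicMatroidOf {α W : Type*} (M : Matroid α) (ends : α → Sym2 W) : Prop :=
  ∀ X : Set α, M.Indep X ↔ X ⊆ M.E ∧ IsForest ends X

/-! ### Instances and their presentation to the machine -/

/-- A graph `G` with the vertices `0, …, n - 1`, a digraph `D` on its edges, a list of the `m`
edges of `G` by their ends, and a list of the `r` arcs of `D`, without repetitions, by the
positions of their tails and heads in the list of edges. -/
structure Instance where
  n : ℕ
  G : SimpleGraph (Fin n)
  D : Digraph G.edgeSet
  m : ℕ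
  edge : Fin m ≃ G.edgeSet
  fst : Fin m → Fin n
  snd : Fin m → Fin n
  edge_eq : ∀ i, (edge i : Sym2 (Fin n)) = s(fst i, snd i)
  r : ℕ
  tail : Fin r → Fin m
  head : Fin r → Fin m
  adj_iff : ∀ i j, D.Adj (edge i) (edge j) ↔ ∃ k, tail k = i ∧ head k = j
  arc_injective : Function.Injective fun k => (tail k, head k)

/-- The size of an instance: the number of vertices, edges and arcs. -/
def Instance.size (I : Instance) : ℕ := I.n + I.m + I.r

/-- A finite list of numbers as the contents of an array, padded with zeros. -/
def toArray {k b : ℕ} (f : Fin k → Fin b) (i : ℕ) : ℕ :=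
  if h : i < k then (f ⟨i, h⟩ : ℕ) else 0

/-- The initial store: the numbers `n`, `m`, `r` in the registers `0`, `1`, `2`, the two ends of
the edges in the arrays `0` and `1`, the tails and the heads of the arcs in the arrays `2` and
`3`; all else is zero. -/
def Instance.input (I : Instance) : Store where
  reg x := match x with
    | 0 => I.n
    | 1 => I.m
    | 2 => I.r
    | _ => 0
  arr a := match a with
    | 0 => toArray I.fst
    | 1 => toArray I.snd
    | 2 => toArray I.tail
    | 3 => toArray I.head
    | _ => fun _ => 0

end DCST

/-!
Since `ℓ e = u e = |dep e|`, a spanning tree is a solution if and only if its edge set is closed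
under `dep`. Dependencies have no dependencies themselves, because the components of `D` are paths
of length at most one, so `dep X` lies outside `S` for every set `X`. If `T` is a solution, then
`X = E(T) ∩ S` is a set such that `dep X` is acyclic and `(E \ S) ∪ X` is connected; conversely,
for such an `X ⊆ S` the forest `dep X` extends within `(E \ S) ∪ X` to a spanning tree, which is a
solution. An edge has at most one dependency, different for different edges, so the first condition
is independence in the graphic matroid `M₁`. The second says that `X` is connected and spanning in
`H`, and after the removal of superfluous elements that `X` is a spanning tree of `H`, that is,
independent in `M₂` and of size `k - 1`.

It remains to find a largest common independent set of two matroids whose closure operators can be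
computed by searches for paths in `G`. Starting from the empty set, one takes the symmetric
difference with an augmenting path of the exchange graph as long as there is one. A set of vertices
that is minimal with an augmenting path inside, as a greedy deletion finds it, is traversed by a
path without shortcuts, and this makes the matrix of the exchanges triangular, so that they can be
performed simultaneously. When there is no augmenting path, the vertices reachable from the sources
are a set `U` for which the ranks of `U` in `M₂` and of its complement in `M₁` add up to the size of
the common independent set. On the machine, path searches, greedy deletions and augmentations are
all instances of one construction: iterating a decidable comprehension of subsets of `{0, …, N - 1}`
`N` times.
-/

namespace DCST

/-! ### Running times of programs -/

/-- The program `p`, started in `s`, halts after at most `B` steps in a store satisfying `Q`. -/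
def Runs (p : Prog) (s : Store) (B : ℕ) (Q : Store → Prop) : Prop :=
  ∃ s' t, Exec p s s' t ∧ t ≤ B ∧ Q s'

section Runs

variable {p q : Prog} {s : Store} {B B' : ℕ} {Q Q' : Store → Prop} {x y z a c n : ℕ}

theorem Runs.mono (h : Runs p s B Q) (hB : B ≤ B') (hQ : ∀ s, Q s → Q' s) : Runs p s B' Q' := by
  obtain ⟨s', t, he, ht, hq⟩ := h
  exact ⟨s', t, he, ht.trans hB, hQ _ hq⟩

theorem Runs.seq (h : Runs p s B fun s' => Runs q s' B' Q) : Runs (.seq p q) s (B + B') Q := by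
  obtain ⟨s', t, he, ht, s'', t', he', ht', hq⟩ := h
  exact ⟨s'', t + t', .seq he he', add_le_add ht ht', hq⟩

theorem Runs.const (h : Q (s.setReg x c)) : Runs (.const x c) s 1 Q :=
  ⟨_, _, .const s x c, le_rfl, h⟩

theorem Runs.add (h : Q (s.setReg x (s.reg y + s.reg z))) : Runs (.add x y z) s 1 Q :=
  ⟨_, _, .add s x y z, le_rfl, h⟩

theorem Runs.sub (h : Q (s.setReg x (s.reg y - s.reg z))) : Runs (.sub x y z) s 1 Q :=
  ⟨_, _, .sub s x y z, le_rfl, h⟩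

theorem Runs.load (h : Q (s.setReg x (s.arr a (s.reg y)))) : Runs (.load x a y) s 1 Q :=
  ⟨_, _, .load s x a y, le_rfl, h⟩

theorem Runs.store (h : Q (s.setArr a (s.reg x) (s.reg y))) : Runs (.store a x y) s 1 Q :=
  ⟨_, _, .store s a x y, le_rfl, h⟩

theorem Runs.ite (h : s.reg x < s.reg y → Runs p s B Q) (h' : ¬ s.reg x < s.reg y → Runs q s B Q) :
    Runs (.ite x y p q) s (B + 1) Q := by
  by_cases hxy : s.reg x < s.reg y
  · obtain ⟨s', t, he, ht, hq⟩ := h hxy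
    exact ⟨s', t + 1, .iteTrue hxy he, by omega, hq⟩
  · obtain ⟨s', t, he, ht, hq⟩ := h' hxy
    exact ⟨s', t + 1, .iteFalse hxy he, by omega, hq⟩

theorem Runs.loop {Inv : ℕ → Store → Prop}
    (hinv : ∀ i s, Inv i s → s.reg x = i ∧ s.reg y = n)
    (hbody : ∀ i < n, ∀ s, Inv i s → Runs p s B (Inv (i + 1))) (h : Inv 0 s) :
    Runs (.loop x y p) s (n * (B + 1) + 1) (Inv n) := by
  suffices H : ∀ k i s, i + k = n → Inv i s → Runs (.loop x y p) s (k * (B + 1) + 1) (Inv n) from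
    H n 0 s (by omega) h
  intro k
  induction k with
  | zero =>
    rintro i s rfl h
    obtain ⟨hx, hy⟩ := hinv _ _ h
    exact ⟨s, 1, .loopDone (by simp [hx, hy]), by simp, h⟩
  | succ k ih =>
    rintro i s rfl h
    obtain ⟨hx, hy⟩ := hinv _ _ h
    obtain ⟨s', t, he, ht, hs'⟩ := hbody i (by omega) s h
    obtain ⟨s'', t', he', ht', hs''⟩ := ih (i + 1) s' (by omega) hs'
    refine ⟨s'', t + t' + 1, .loopStep (by omega) he he', ?_, hs''⟩
    rw [Nat.succ_mul]
    omega

end Runs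

@[simp] theorem Store.reg_setReg (s : Store) (x v : ℕ) :
    (s.setReg x v).reg = Function.update s.reg x v := rfl

@[simp] theorem Store.arr_setArr (s : Store) (a i v : ℕ) :
    (s.setArr a i v).arr = Function.update s.arr a (Function.update (s.arr a) i v) := rfl

/-- The loop `for x := 0, 1, …` that executes `p` as long as `reg x < reg y`, with register
`x + 1` as scratch space. -/
def Prog.forLoop (x y : ℕ) (p : Prog) : Prog :=
  .seq (.const x 0) (.loop x y (.seq p (.seq (.const (x + 1) 1) (.add x x (x + 1)))))

theorem Runs.forLoop {p : Prog} {s : Store} {B x y n : ℕ} {Inv : ℕ → Store → Prop}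
    (hframe : ∀ i s z v, x ≤ z → Inv i s → Inv i (s.setReg z v))
    (hinv : ∀ i s, Inv i s → s.reg y = n)
    (hbody : ∀ i < n, ∀ s, Inv i s → s.reg x = i →
      Runs p s B fun s' => Inv (i + 1) s' ∧ s'.reg x = i) (h : Inv 0 s) :
    Runs (.forLoop x y p) s (n * (B + 3) + 2) (Inv n) := by
  have hloop := Runs.loop (x := x) (p := .seq p (.seq (.const (x + 1) 1) (.add x x (x + 1))))
    (B := B + (1 + 1)) (Inv := fun i s => s.reg x = i ∧ Inv i s)
    (fun i s hs => ⟨hs.1, hinv i s hs.2⟩)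
    (fun i hi s hs => Runs.seq <| (hbody i hi s hs.2 hs.1).mono le_rfl fun s' hs' =>
      Runs.seq <| Runs.const <| Runs.add
        ⟨by simp [hs'.2], hframe _ _ _ _ le_rfl (hframe _ _ _ _ (Nat.le_succ x) hs'.1)⟩)
    (s := s.setReg x 0) ⟨by simp, hframe _ _ _ _ le_rfl h⟩
  exact (Runs.seq (Runs.const hloop)).mono (le_of_eq (by ring)) fun _ hs => hs.2

/-- The stores agree on the registers below `d` and on the arrays below `a`. -/
structure Agree (d a : ℕ) (s s' : Store) : Prop where
  reg : ∀ x < d, s'.reg x = s.reg x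
  arr : ∀ k < a, s'.arr k = s.arr k

namespace Agree

variable {d d' a a' x i v : ℕ} {s s' s'' : Store}

theorem refl (d a : ℕ) (s : Store) : Agree d a s s := ⟨fun _ _ => rfl, fun _ _ => rfl⟩

theorem mono (h : Agree d' a' s s') (hd : d ≤ d') (ha : a ≤ a') : Agree d a s s' :=
  ⟨fun x hx => h.reg x (hx.trans_le hd), fun k hk => h.arr k (hk.trans_le ha)⟩

theorem trans (h : Agree d a s s') (h' : Agree d a s' s'') : Agree d a s s'' :=
  ⟨fun x hx => (h'.reg x hx).trans (h.reg x hx), fun k hk => (h'.arr k hk).trans (h.arr k hk)⟩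

theorem setReg (s : Store) (a v : ℕ) (hx : d ≤ x) : Agree d a s (s.setReg x v) :=
  ⟨fun y hy => by rw [Store.reg_setReg, Function.update_of_ne (by omega)], fun _ _ => rfl⟩

theorem setArr (s : Store) (d i v : ℕ) (hx : a ≤ x) : Agree d a s (s.setArr x i v) :=
  ⟨fun _ _ => rfl, fun k hk => by rw [Store.arr_setArr, Function.update_of_ne (by omega)]⟩

end Agree

/-- A program turns the precondition into the postcondition in a number of steps polynomial in
`N`, and leaves the registers below `d` and the arrays below `a` alone. -/
def PolyTriple {Γ : Type} (N : Γ → ℕ) (d a : ℕ) (Pre Post : Γ → Store → Prop) : Prop :=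
  ∃ (P : Prog) (b : Polynomial ℕ), ∀ γ s, Pre γ s →
    Runs P s (b.eval (N γ)) fun s' => Agree d a s s' ∧ Post γ s'

namespace PolyTriple

variable {Γ Δ : Type} {N : Γ → ℕ} {d d' a a' : ℕ} {Pre Pre' Mid Post Post' : Γ → Store → Prop}

theorem of_runs {P : Prog} (B : ℕ)
    (h : ∀ γ s, Pre γ s → Runs P s B fun s' => Agree d a s s' ∧ Post γ s') :
    PolyTriple N d a Pre Post :=
  ⟨P, .C B, fun γ s hs => by simpa only [Polynomial.eval_C] using h γ s hs⟩

theorem imp (h : PolyTriple N d' a' Pre Post) (hd : d ≤ d') (ha : a ≤ a')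
    (hpre : ∀ γ s, Pre' γ s → Pre γ s)
    (hpost : ∀ γ s s', Pre' γ s → Agree d' a' s s' → Post γ s' → Post' γ s') :
    PolyTriple N d a Pre' Post' := by
  obtain ⟨P, b, hP⟩ := h
  exact ⟨P, b, fun γ s hs => (hP γ s (hpre γ s hs)).mono le_rfl fun s' hs' =>
    ⟨hs'.1.mono hd ha, hpost γ s s' hs hs'.1 hs'.2⟩⟩

theorem comap (h : PolyTriple N d a Pre Post) (g : Δ → Γ) :
    PolyTriple (fun δ => N (g δ)) d a (fun δ => Pre (g δ)) fun δ => Post (g δ) := by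
  obtain ⟨P, b, hP⟩ := h
  exact ⟨P, b, fun δ => hP (g δ)⟩

theorem seq (h : PolyTriple N d a Pre Mid) (h' : PolyTriple N d a Mid Post) :
    PolyTriple N d a Pre Post := by
  obtain ⟨P, b, hP⟩ := h
  obtain ⟨P', b', hP'⟩ := h'
  refine ⟨.seq P P', b + b', fun γ s hs => ?_⟩
  rw [Polynomial.eval_add]
  exact Runs.seq <| (hP γ s hs).mono le_rfl fun s₁ h₁ => (hP' γ s₁ h₁.2).mono le_rfl
    fun s₂ h₂ => ⟨h₁.1.trans h₂.1, h₂.2⟩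

theorem forLoop {Inv : Γ → ℕ → Store → Prop} {x : ℕ} (hx : d ≤ x)
    (hframe : ∀ γ i s z v, x ≤ z → Inv γ i s → Inv γ i (s.setReg z v))
    (hinv : ∀ γ i s, Inv γ i s → s.reg 0 = N γ)
    (hbody : PolyTriple (fun p : Γ × ℕ => N p.1) d a
      (fun p s => p.2 < N p.1 ∧ Inv p.1 p.2 s ∧ s.reg x = p.2)
      fun p s => Inv p.1 (p.2 + 1) s ∧ s.reg x = p.2) :
    PolyTriple N d a (fun γ => Inv γ 0) fun γ => Inv γ (N γ) := by
  obtain ⟨P, b, hP⟩ := hbody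
  refine ⟨.forLoop x 0 P, .X * (b + 3) + 2, fun γ s hs => ?_⟩
  refine (Runs.forLoop (B := b.eval (N γ)) (Inv := fun i s' => Agree d a s s' ∧ Inv γ i s')
    (fun i s' z v hz h => ⟨h.1.trans (Agree.setReg s' a v (hx.trans hz)),
      hframe γ i s' z v hz h.2⟩)
    (fun i s' h => hinv γ i s' h.2)
    (fun i hi s' h hi' => (hP (γ, i) s' ⟨hi, h.2, hi'⟩).mono le_rfl
      fun s'' h' => ⟨⟨h.1.trans h'.1, h'.2.1⟩, h'.2.2⟩)
    ⟨Agree.refl d a s, hs⟩).mono (by simp) fun _ h => h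

end PolyTriple

/-! ### Computability in polynomial time -/

open Classical in
/-- The number that stands for the truth value of `p` in a register or in an array. -/
noncomputable def truthValue (p : Prop) : ℕ := if p then 1 else 0

@[simp] theorem truthValue_pos {p : Prop} : 0 < truthValue p ↔ p := by
  by_cases h : p <;> simp [truthValue, h]

/-- A way to keep the members of `Γ` in the registers below `d` and the arrays below `a`, with
the number `N` that bounds the loops and the running time in register `0`. -/
structure Rep (Γ : Type) where
  Holds : Γ → Store → Prop
  d : ℕ
  a : ℕ
  N : Γ → ℕ
  d_pos : 0 < d
  reg_zero {γ s} : Holds γ s → s.reg 0 = N γ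
  congr {γ s s'} : Holds γ s → Agree d a s s' → Holds γ s'

section Rep

variable {Γ Δ : Type} {R : Rep Γ} {R' : Rep Δ} {g : Δ → Γ}

/-- One more number, kept in the register `x`. -/
def Rep.withReg (R : Rep Γ) (x : ℕ) : Rep (Γ × ℕ) where
  Holds p s := R.Holds p.1 s ∧ s.reg x = p.2
  d := max R.d (x + 1)
  a := R.a
  N p := R.N p.1
  d_pos := by omega
  reg_zero h := R.reg_zero h.1
  congr h h' := ⟨R.congr h.1 (h'.mono (by omega) le_rfl), (h'.reg _ (by omega)).trans h.2⟩

/-- One more set of numbers below the bound, kept in the array `k` as a list of truth values. -/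
def Rep.withArr (R : Rep Γ) (k : ℕ) : Rep (Γ × Set ℕ) where
  Holds p s := R.Holds p.1 s ∧ p.2 ⊆ Set.Iio (R.N p.1) ∧
    ∀ i < R.N p.1, s.arr k i = truthValue (i ∈ p.2)
  d := R.d
  a := max R.a (k + 1)
  N p := R.N p.1
  d_pos := R.d_pos
  reg_zero h := R.reg_zero h.1
  congr h h' := ⟨R.congr h.1 (h'.mono le_rfl (by omega)), h.2.1,
    fun i hi => by rw [h'.arr k (by omega), h.2.2 i hi]⟩

/-- The representation `R'` of `δ` contains the representation `R` of `g δ`. -/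
structure Extends (R' : Rep Δ) (R : Rep Γ) (g : Δ → Γ) : Prop where
  holds {δ s} : R'.Holds δ s → R.Holds (g δ) s
  d_le : R.d ≤ R'.d
  a_le : R.a ≤ R'.a
  N_eq : ∀ δ, R'.N δ = R.N (g δ)

namespace Extends

theorem refl (R : Rep Γ) : Extends R R fun γ => γ := ⟨id, le_rfl, le_rfl, fun _ => rfl⟩

theorem withReg (h : Extends R' R g) (x : ℕ) : Extends (R'.withReg x) R fun p => g p.1 :=
  ⟨fun hs => h.holds hs.1, h.d_le.trans (le_max_left ..), h.a_le, fun _ => h.N_eq _⟩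

theorem withArr (h : Extends R' R g) (k : ℕ) : Extends (R'.withArr k) R fun p => g p.1 :=
  ⟨fun hs => h.holds hs.1, h.d_le, h.a_le.trans (le_max_left ..), fun _ => h.N_eq _⟩

theorem withReg_withReg (h : Extends R' R g) (x : ℕ) :
    Extends (R'.withReg x) (R.withReg x) fun p => (g p.1, p.2) :=
  ⟨fun hs => ⟨h.holds hs.1, hs.2⟩, max_le_max h.d_le le_rfl, h.a_le, fun _ => h.N_eq _⟩

theorem withArr_withArr (h : Extends R' R g) (k : ℕ) :
    Extends (R'.withArr k) (R.withArr k) fun p => (g p.1, p.2) :=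
  ⟨fun hs => ⟨h.holds hs.1, h.N_eq _ ▸ hs.2⟩, h.d_le, max_le_max h.a_le le_rfl, fun _ => h.N_eq _⟩

end Extends

/-- `f` is computable in polynomial time, with the result in any register `d` above those of the
representation, and with the registers and arrays from `d` and `a` on as scratch space. -/
def PolyFun (R : Rep Γ) (f : Γ → ℕ) : Prop :=
  ∀ d ≥ R.d, ∀ a ≥ R.a, PolyTriple R.N d a R.Holds fun γ s => s.reg d = f γ

/-- `φ` is decidable in polynomial time. -/
def PolyDec (R : Rep Γ) (φ : Γ → Prop) : Prop := PolyFun R fun γ => truthValue (φ γ)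

/-- `F` is computable in polynomial time as a function of one more number. -/
def PolyMap (R : Rep Γ) (F : Γ → ℕ → ℕ) : Prop :=
  ∀ x ≥ R.d, PolyFun (R.withReg x) fun p => F p.1 p.2

/-- The predicate `φ` of one more number is decidable in polynomial time. -/
def PolyPred (R : Rep Γ) (φ : Γ → ℕ → Prop) : Prop :=
  ∀ x ≥ R.d, PolyDec (R.withReg x) fun p => φ p.1 p.2

/-- The relation `ρ` between two more numbers is decidable in polynomial time. -/
def PolyRel (R : Rep Γ) (ρ : Γ → ℕ → ℕ → Prop) : Prop :=
  ∀ x ≥ R.d, PolyPred (R.withReg x) fun p => ρ p.1 p.2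

/-- The part of `X` below the bound is computable in polynomial time, with the result in any
array `a` above those of the representation. -/
def PolySet (R : Rep Γ) (X : Γ → Set ℕ) : Prop :=
  ∀ d ≥ R.d, ∀ a ≥ R.a, PolyTriple R.N d a R.Holds fun γ s =>
    ∀ i < R.N γ, s.arr a i = truthValue (i ∈ X γ)

variable {f h x y : Γ → ℕ} {F : Γ → ℕ → ℕ} {φ ψ : Γ → Prop} {X : Γ → Set ℕ}
  {ρ : Γ → ℕ → Prop}

theorem PolyFun.congr (hf : PolyFun R f) (H : ∀ γ, f γ = h γ) : PolyFun R h :=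
  funext H ▸ hf

theorem PolyDec.congr (hφ : PolyDec R φ) (H : ∀ γ, φ γ ↔ ψ γ) : PolyDec R ψ :=
  PolyFun.congr hφ fun γ => by rw [H γ]

theorem PolyFun.comap (hf : PolyFun R f) (hR : Extends R' R g) : PolyFun R' fun δ => f (g δ) := by
  intro d hd a ha
  have := (hf d (hR.d_le.trans hd) a (hR.a_le.trans ha)).comap g
  simp only [← hR.N_eq] at this
  exact this.imp le_rfl le_rfl (fun _ _ => hR.holds) fun _ _ _ _ _ => id

theorem PolyDec.comap (hφ : PolyDec R φ) (hR : Extends R' R g) :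
    PolyDec R' fun δ => φ (g δ) :=
  PolyFun.comap (f := fun γ => truthValue (φ γ)) hφ hR

theorem PolyMap.comap (hF : PolyMap R F) (hR : Extends R' R g) :
    PolyMap R' fun δ => F (g δ) :=
  fun x hx => (hF x (hR.d_le.trans hx)).comap (hR.withReg_withReg x)

theorem PolySet.comap (hX : PolySet R X) (hR : Extends R' R g) :
    PolySet R' fun δ => X (g δ) := by
  intro d hd a ha
  have := (hX d (hR.d_le.trans hd) a (hR.a_le.trans ha)).comap g
  simp only [← hR.N_eq] at this
  exact this.imp le_rfl le_rfl (fun _ _ => hR.holds) fun _ _ _ _ _ => id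

theorem PolyFun.holds_withReg (hf : PolyFun R f) {d a : ℕ} (hd : R.d ≤ d) (ha : R.a ≤ a) :
    PolyTriple R.N d a R.Holds fun γ s => (R.withReg d).Holds (γ, f γ) s :=
  (hf d hd a ha).imp le_rfl le_rfl (fun _ _ => id) fun _ _ _ hs h hs' =>
    ⟨R.congr hs (h.mono hd ha), hs'⟩

theorem PolySet.holds_withArr (hX : PolySet R X) (hlt : ∀ γ, X γ ⊆ Set.Iio (R.N γ)) {d a : ℕ}
    (hd : R.d ≤ d) (ha : R.a ≤ a) :
    PolyTriple R.N d a R.Holds fun γ s => (R.withArr a).Holds (γ, X γ) s :=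
  (hX d hd a ha).imp le_rfl le_rfl (fun _ _ => id) fun γ _ _ hs h hs' =>
    ⟨R.congr hs (h.mono hd ha), hlt γ, hs'⟩

theorem PolyFun.of_reg {r : ℕ} (hr : r < R.d) (H : ∀ γ s, R.Holds γ s → s.reg r = f γ) :
    PolyFun R f := by
  intro d hd a _
  refine .of_runs (P := .seq (.const d 0) (.add d d r)) (1 + 1) fun γ s hs =>
    Runs.seq <| Runs.const <| Runs.add
      ⟨(Agree.setReg s a _ le_rfl).trans (Agree.setReg _ a _ le_rfl), ?_⟩
  have hrd : r ≠ d := by omega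
  simp [hrd, H γ s hs]

theorem polyFun_snd {r : ℕ} : PolyFun (R.withReg r) Prod.snd :=
  .of_reg (r := r) (by simp [Rep.withReg]) fun _ _ h => h.2

theorem polyFun_bound : PolyFun R R.N := .of_reg R.d_pos fun _ _ => R.reg_zero

theorem polyFun_const (c : ℕ) : PolyFun R fun _ => c := fun d _ a _ =>
  .of_runs 1 fun _ s _ => Runs.const ⟨Agree.setReg s a c le_rfl, by simp⟩

theorem PolyFun.binop {op : ℕ → Prog} {F : ℕ → ℕ → ℕ} {c : ℕ} (hf : PolyFun R f)
    (hh : PolyFun R h)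
    (hop : ∀ d a s, Runs (op d) s c fun s' => Agree d a s s' ∧
      s'.reg d = F (s.reg d) (s.reg (d + 1))) : PolyFun R fun γ => F (f γ) (h γ) := by
  intro d hd a ha
  have hh' := (hh.comap ((Extends.refl R).withReg d) (d + 1)
    (by simp only [Rep.withReg]; omega) a ha).comap fun γ => (γ, f γ)
  refine (hf.holds_withReg hd ha).seq <| (hh'.imp (Post' := fun γ s => s.reg d = f γ ∧
    s.reg (d + 1) = h γ) (Nat.le_succ d) le_rfl (fun _ _ => id) fun γ s s' hs hag hs' =>
      ⟨(hag.reg d (by omega)).trans hs.2, hs'⟩).seq <|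
    .of_runs c fun γ s hs => (hop d a s).mono le_rfl fun s' hs' => ?_
  rwa [hs.1, hs.2] at hs'

theorem PolyFun.add (hf : PolyFun R f) (hh : PolyFun R h) : PolyFun R fun γ => f γ + h γ :=
  hf.binop (op := fun d => .add d d (d + 1)) hh fun _ a s =>
    Runs.add ⟨Agree.setReg s a _ le_rfl, by simp⟩

theorem PolyFun.sub (hf : PolyFun R f) (hh : PolyFun R h) : PolyFun R fun γ => f γ - h γ :=
  hf.binop (op := fun d => .sub d d (d + 1)) hh fun _ a s =>
    Runs.sub ⟨Agree.setReg s a _ le_rfl, by simp⟩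

theorem PolyMap.app (hF : PolyMap R F) (hx : PolyFun R x) : PolyFun R fun γ => F γ (x γ) := by
  intro d hd a ha
  have hF' := (hF d hd (d + 1) (by simp only [Rep.withReg]; omega) a ha).comap fun γ => (γ, x γ)
  refine (hx.holds_withReg hd ha).seq <| (hF'.imp (Nat.le_succ d) le_rfl (fun _ _ => id)
    fun _ _ _ _ _ => id).seq <| .of_runs (P := .seq (.const d 0) (.add d d (d + 1))) (1 + 1)
    fun γ s hs => Runs.seq <| Runs.const <| Runs.add
      ⟨(Agree.setReg s a _ le_rfl).trans (Agree.setReg _ a _ le_rfl), by simp [hs]⟩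

theorem PolyPred.polyMap (hρ : PolyPred R ρ) : PolyMap R fun γ i => truthValue (ρ γ i) := hρ

theorem PolyPred.app (hρ : PolyPred R ρ) (hx : PolyFun R x) : PolyDec R fun γ => ρ γ (x γ) :=
  hρ.polyMap.app hx

theorem PolyPred.comap (hρ : PolyPred R ρ) (hR : Extends R' R g) :
    PolyPred R' fun δ => ρ (g δ) :=
  hρ.polyMap.comap hR

theorem PolyRel.app {σ : Γ → ℕ → ℕ → Prop} (hσ : PolyRel R σ) (hx : PolyFun R x)
    (hy : PolyFun R y) : PolyDec R fun γ => σ γ (x γ) (y γ) :=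
  PolyMap.app (F := fun γ i => truthValue (σ γ i (y γ)))
    (fun r hr => (hσ r hr).app (hy.comap ((Extends.refl R).withReg r))) hx

theorem PolyRel.comap {σ : Γ → ℕ → ℕ → Prop} (hσ : PolyRel R σ) (hR : Extends R' R g) :
    PolyRel R' fun δ => σ (g δ) :=
  fun r hr => (hσ r (hR.d_le.trans hr)).comap (hR.withReg_withReg r)

theorem PolyFun.pos (hf : PolyFun R f) : PolyDec R fun γ => 0 < f γ :=
  ((polyFun_const 1).sub ((polyFun_const 1).sub hf)).congr fun γ => by
    unfold truthValue
    split_ifs <;> omega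

theorem PolyFun.lt (hf : PolyFun R f) (hh : PolyFun R h) : PolyDec R fun γ => f γ < h γ :=
  (hh.sub hf).pos.congr fun _ => Nat.sub_pos_iff_lt

theorem PolyDec.not (hφ : PolyDec R φ) : PolyDec R fun γ => ¬ φ γ :=
  ((polyFun_const 1).sub hφ).congr fun γ => by by_cases h : φ γ <;> simp [truthValue, h]

theorem PolyDec.or (hφ : PolyDec R φ) (hψ : PolyDec R ψ) : PolyDec R fun γ => φ γ ∨ ψ γ :=
  (PolyFun.add hφ hψ).pos.congr fun γ => by simp

theorem PolyDec.and (hφ : PolyDec R φ) (hψ : PolyDec R ψ) : PolyDec R fun γ => φ γ ∧ ψ γ :=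
  (hφ.not.or hψ.not).not.congr fun γ => by tauto

theorem PolyFun.eq (hf : PolyFun R f) (hh : PolyFun R h) : PolyDec R fun γ => f γ = h γ :=
  ((hf.lt hh).or (hh.lt hf)).not.congr fun γ => by rw [← ne_iff_lt_or_gt, not_not]

theorem PolyMap.of_arr {k : ℕ} (H : ∀ γ s, R.Holds γ s → s.arr k = F γ) :
    PolyMap R F := by
  intro x _ d _ a _
  refine .of_runs 1 fun p s hs => Runs.load (a := k) (y := x) ⟨Agree.setReg s a _ le_rfl, ?_⟩
  simp [hs.2, H _ s hs.1]

theorem polyPred_mem_snd {k : ℕ} : PolyPred (R.withArr k) fun p i => i ∈ p.2 := by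
  intro x hx d hd a ha
  simp only [Rep.withReg, Rep.withArr] at hx hd ha
  have := R.d_pos
  refine .of_runs (P := .ite x 0 (.load d k x) (.const d 0)) (1 + 1) fun p s hs => ?_
  obtain ⟨⟨hR, hlt, harr⟩, hx⟩ := hs
  rw [← R.reg_zero hR] at hlt harr
  refine Runs.ite (fun h => Runs.load ⟨Agree.setReg s a _ le_rfl, ?_⟩)
    fun h => Runs.const ⟨Agree.setReg s a _ le_rfl, ?_⟩
  · simpa [hx] using harr _ (hx ▸ h)
  · have : p.2 ∉ p.1.2 := fun hp => h (hx ▸ hlt hp)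
    simp [truthValue, this]

theorem PolyMap.sum (hF : PolyMap R F) :
    PolyFun R fun γ => ∑ i ∈ Finset.range (R.N γ), F γ i := by
  intro d hd a ha
  let Inv : Γ → ℕ → Store → Prop := fun γ i s =>
    R.Holds γ s ∧ s.reg d = ∑ j ∈ Finset.range i, F γ j
  have hframe : ∀ γ i s z v, d + 1 ≤ z → Inv γ i s → Inv γ i (s.setReg z v) := by
    intro γ i s z v hz hs
    have hag := Agree.setReg s R.a v hz
    exact ⟨R.congr hs.1 (hag.mono (by omega) le_rfl), (hag.reg d (by omega)).trans hs.2⟩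
  have hterm : PolyTriple (fun p : Γ × ℕ => R.N p.1) d a
      (fun p s => p.2 < R.N p.1 ∧ Inv p.1 p.2 s ∧ s.reg (d + 1) = p.2)
      fun p s => (Inv p.1 p.2 s ∧ s.reg (d + 1) = p.2) ∧ s.reg (d + 2) = F p.1 p.2 := by
    refine (hF (d + 1) (by omega) (d + 2) (by simp only [Rep.withReg]; omega) a ha).imp
      (by omega) le_rfl (fun p s hs => ⟨hs.2.1.1, hs.2.2⟩) fun p s s' hs hag hs' =>
        ⟨⟨⟨R.congr hs.2.1.1 (hag.mono (by omega) ha), ?_⟩, ?_⟩, hs'⟩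
    · rw [hag.reg d (by omega), hs.2.1.2]
    · rw [hag.reg (d + 1) (by omega), hs.2.2]
  refine (PolyTriple.of_runs (P := .const d 0) 1 fun γ s hs =>
      Runs.const ⟨Agree.setReg s a 0 le_rfl, ?_⟩).seq <|
    (PolyTriple.forLoop (Inv := Inv) (x := d + 1) (Nat.le_succ d) hframe
      (fun γ i s hs => R.reg_zero hs.1) (hterm.seq <|
        .of_runs (P := .add d d (d + 2)) 1 fun p s hs =>
          Runs.add ⟨Agree.setReg s a _ le_rfl, ⟨?_, ?_⟩, ?_⟩)).imp le_rfl le_rfl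
      (fun _ _ => id) fun _ _ _ _ _ hs => hs.2
  · exact ⟨R.congr hs (Agree.setReg s R.a 0 hd), by simp⟩
  · exact R.congr hs.1.1.1 (Agree.setReg s R.a _ hd)
  · simp [Finset.sum_range_succ, hs.2, hs.1.1.2]
  · simp [hs.1.2]

theorem PolyPred.exists_lt_bound (hρ : PolyPred R ρ) : PolyDec R fun γ => ∃ i < R.N γ, ρ γ i :=
  hρ.polyMap.sum.pos.congr fun γ => by simp [Finset.sum_pos_iff]

theorem PolyPred.exists_lt (hρ : PolyPred R ρ) (hf : PolyFun R f) (hle : ∀ γ, f γ ≤ R.N γ) :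
    PolyDec R fun γ => ∃ i < f γ, ρ γ i :=
  (PolyPred.exists_lt_bound (ρ := fun γ i => i < f γ ∧ ρ γ i) fun r hr =>
    (polyFun_snd.lt (hf.comap ((Extends.refl R).withReg r))).and (hρ r hr)).congr fun γ =>
    ⟨fun ⟨i, _, h⟩ => ⟨i, h⟩, fun ⟨i, h⟩ => ⟨i, h.1.trans_le (hle γ), h⟩⟩

theorem PolyPred.forall_lt (hρ : PolyPred R ρ) (hf : PolyFun R f) (hle : ∀ γ, f γ ≤ R.N γ) :
    PolyDec R fun γ => ∀ i < f γ, ρ γ i :=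
  (PolyPred.exists_lt (ρ := fun γ i => ¬ ρ γ i) (fun r hr => PolyDec.not (hρ r hr)) hf
    hle).not.congr fun γ => by simp

theorem PolyMap.fill (hF : PolyMap R F) {d a t : ℕ} (hd : R.d ≤ d) (ha : a ≤ t)
    (hR : ∀ γ s i v, R.Holds γ s → R.Holds γ (s.setArr t i v)) :
    PolyTriple R.N d a R.Holds fun γ s => R.Holds γ s ∧ ∀ i < R.N γ, s.arr t i = F γ i := by
  let Inv : Γ → ℕ → Store → Prop := fun γ i s => R.Holds γ s ∧ ∀ j < i, s.arr t j = F γ j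
  have hval : PolyTriple (fun p : Γ × ℕ => R.N p.1) d a
      (fun p s => p.2 < R.N p.1 ∧ Inv p.1 p.2 s ∧ s.reg d = p.2)
      fun p s => (Inv p.1 p.2 s ∧ s.reg d = p.2) ∧ s.reg (d + 1) = F p.1 p.2 := by
    refine (hF d hd (d + 1) (by simp only [Rep.withReg]; omega) (max R.a (t + 1))
      (le_max_left ..)).imp (by omega) (by omega) (fun p s hs => ⟨hs.2.1.1, hs.2.2⟩)
      fun p s s' hs hag hs' => ⟨⟨⟨R.congr hs.2.1.1 (hag.mono (by omega) (by omega)), ?_⟩, ?_⟩, hs'⟩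
    · rw [hag.arr t (by omega)]
      exact hs.2.1.2
    · rw [hag.reg d (by omega), hs.2.2]
  refine (PolyTriple.forLoop (Inv := Inv) (x := d) le_rfl
    (fun γ i s z v hz hs => ⟨R.congr hs.1 (Agree.setReg s R.a v (hd.trans hz)), hs.2⟩)
    (fun γ i s hs => R.reg_zero hs.1) (hval.seq <|
      .of_runs (P := .store t d (d + 1)) 1 fun p s hs => Runs.store
        ⟨Agree.setArr s d _ _ ha, ⟨hR _ _ _ _ hs.1.1.1, fun j hj => ?_⟩, hs.1.2⟩)).imp le_rfl
    le_rfl (fun γ s hs => ⟨hs, by simp⟩) fun _ _ _ _ _ => id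
  rw [hs.1.2, hs.2, Store.arr_setArr, Function.update_self]
  rcases Nat.lt_succ_iff_lt_or_eq.1 hj with hj | rfl
  · rw [Function.update_of_ne hj.ne, hs.1.1.2 j hj]
  · rw [Function.update_self]

theorem PolyPred.polySet (hX : PolyPred R fun γ i => i ∈ X γ) : PolySet R X :=
  fun _ hd _ ha => (hX.polyMap.fill hd le_rfl fun _ s _ _ hs =>
    R.congr hs (Agree.setArr s R.d _ _ ha)).imp le_rfl le_rfl (fun _ _ => id)
      fun _ _ _ _ _ hs => hs.2

/-- The sets obtained from the empty set by iterating the comprehension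
`X ↦ {i | i < N ∧ φ X t i}`, where `t` is the number of the round. -/
def stage (φ : Set ℕ → ℕ → ℕ → Prop) (N : ℕ) : ℕ → Set ℕ
  | 0 => ∅
  | t + 1 => {i | i < N ∧ φ (stage φ N t) t i}

theorem stage_subset_Iio (φ : Set ℕ → ℕ → ℕ → Prop) (N : ℕ) : ∀ t, stage φ N t ⊆ Set.Iio N
  | 0 => Set.empty_subset _
  | _ + 1 => fun _ hi => hi.1

theorem polySet_stage {φ : Γ → Set ℕ → ℕ → ℕ → Prop}
    (hφ : ∀ k ≥ R.a, PolyRel (R.withArr k) fun p => φ p.1 p.2) :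
    PolySet R fun γ => stage (φ γ) (R.N γ) (R.N γ) := by
  intro d hd a ha
  let Inv : Γ → ℕ → Store → Prop := fun γ t s => (R.withArr a).Holds (γ, stage (φ γ) (R.N γ) t) s
  have hempty : PolyTriple R.N d a R.Holds fun γ => Inv γ 0 :=
    PolySet.holds_withArr (X := fun _ => ∅) (PolyPred.polySet fun r _ =>
      (polyFun_const 0).congr fun γ => by simp [truthValue]) (fun _ => Set.empty_subset _) hd ha
  have hnext : PolyTriple (fun p : Γ × ℕ => R.N p.1) d a
      (fun p s => p.2 < R.N p.1 ∧ Inv p.1 p.2 s ∧ s.reg d = p.2)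
      fun p s => ((R.withReg d).withArr (a + 1)).Holds
        (p, stage (φ p.1) (R.N p.1) (p.2 + 1)) s := by
    have hφ' := (PolyPred.polySet (X := fun q => {i | φ q.1.1 q.1.2 q.2 i}) (hφ a ha d hd)
      (d + 1) (by simp only [Rep.withReg, Rep.withArr]; omega) (a + 1)
      (by simp only [Rep.withReg, Rep.withArr]; omega)).comap
      fun p : Γ × ℕ => ((p.1, stage (φ p.1) (R.N p.1) p.2), p.2)
    refine hφ'.imp (Nat.le_succ d) (Nat.le_succ a) (fun p s hs => hs.2) fun p s s' hs hag hs' =>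
      ⟨⟨R.congr hs.2.1.1 (hag.mono (by omega) (by omega)), ?_⟩, stage_subset_Iio _ _ _,
        fun i hi => (hs' i hi).trans ?_⟩
    · rw [hag.reg d (by omega), hs.2.2]
    · have hi : i < R.N p.1 := hi
      simp [stage, hi]
  have hcopy : PolyTriple (fun p : Γ × ℕ => R.N p.1) d a
      (fun p => ((R.withReg d).withArr (a + 1)).Holds (p, stage (φ p.1) (R.N p.1) (p.2 + 1)))
      fun p s => Inv p.1 (p.2 + 1) s ∧ s.reg d = p.2 := by
    have hfill := (PolyMap.fill (R := (R.withReg d).withArr (a + 1)) polyPred_mem_snd.polyMap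
      (d := d + 1) (a := a) (t := a) (by simp only [Rep.withReg, Rep.withArr]; omega) le_rfl
      fun q s i v hs => ⟨⟨R.congr hs.1.1 (Agree.setArr s _ i v ha), hs.1.2⟩, hs.2.1,
        by simpa using hs.2.2⟩).comap
      fun p : Γ × ℕ => (p, stage (φ p.1) (R.N p.1) (p.2 + 1))
    exact hfill.imp (Nat.le_succ d) le_rfl (fun _ _ => id) fun p s s' _ _ hs' =>
      ⟨⟨hs'.1.1.1, hs'.1.2.1, hs'.2⟩, hs'.1.1.2⟩
  exact (hempty.seq <| PolyTriple.forLoop le_rfl (fun γ t s z v hz hs => ⟨R.congr hs.1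
    (Agree.setReg s R.a v (hd.trans hz)), hs.2⟩) (fun γ t s hs => R.reg_zero hs.1)
    (hnext.seq hcopy)).imp le_rfl le_rfl (fun _ _ => id) fun γ s s' _ _ hs => hs.2.2

theorem PolyPred.appSet {ρ : Γ → Set ℕ → ℕ → Prop}
    (hρ : ∀ k ≥ R.a, PolyPred (R.withArr k) fun p => ρ p.1 p.2) (hX : PolySet R X)
    (hlt : ∀ γ, X γ ⊆ Set.Iio (R.N γ)) : PolyPred R fun γ => ρ γ (X γ) := by
  intro x hx d hd a ha
  have hρ' := (hρ a ha x hx d hd (a + 1)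
    (by simp only [Rep.withReg, Rep.withArr] at ha ⊢; omega)).comap
    fun p : Γ × ℕ => ((p.1, X p.1), p.2)
  exact ((hX.comap ((Extends.refl R).withReg x)).holds_withArr (fun p => hlt p.1) hd ha).seq <|
    hρ'.imp le_rfl (Nat.le_succ a) (fun p s hs => ⟨⟨hs.1.1, hs.2⟩, hs.1.2⟩) fun _ _ _ _ _ => id

theorem PolySet.polyPred (hX : PolySet R X) (hlt : ∀ γ, X γ ⊆ Set.Iio (R.N γ)) :
    PolyPred R fun γ i => i ∈ X γ :=
  PolyPred.appSet (ρ := fun _ X i => i ∈ X) (fun _ _ => polyPred_mem_snd) hX hlt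

end Rep

/-! ### Paths in an induced subgraph -/

section Paths

variable {α : Type*} {r : α → α → Prop} {s t : α → Prop} {W W' : Set α} {L : ℕ} {p : ℕ → α}

/-- There is a path within `W`, along the relation `r`, from `s` to `t`. -/
def HasPath (r : α → α → Prop) (s t : α → Prop) (W : Set α) : Prop :=
  ∃ a ∈ W, ∃ b ∈ W, s a ∧ t b ∧ Relation.ReflTransGen (fun u v => u ∈ W ∧ v ∈ W ∧ r u v) a b

theorem HasPath.mono (h : HasPath r s t W) (hW : W ⊆ W') : HasPath r s t W' := by
  obtain ⟨a, ha, b, hb, hs, ht, h⟩ := h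
  exact ⟨a, hW ha, b, hW hb, hs, ht,
    Relation.ReflTransGen.mono (fun u v h => ⟨hW h.1, hW h.2.1, h.2.2⟩) _ _ h⟩

theorem HasPath.swap (h : HasPath r s t W) : HasPath (Function.swap r) t s W := by
  obtain ⟨a, ha, b, hb, hs, ht, h⟩ := h
  exact ⟨b, hb, a, ha, ht, hs, Relation.ReflTransGen.mono
    (fun u v h => ⟨h.2.1, h.1, h.2.2⟩) _ _ (Relation.reflTransGen_swap.2 h)⟩

/-- The sequence `p` is a path of length `L` within `W`, along the relation `r`,
from `s` to `t`. -/
structure IsPathSeq (r : α → α → Prop) (s t : α → Prop) (W : Set α) (L : ℕ) (p : ℕ → α) :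
    Prop where
  mem : ∀ i ≤ L, p i ∈ W
  source : s (p 0)
  sink : t (p L)
  step : ∀ i < L, r (p i) (p (i + 1))

theorem IsPathSeq.hasPath (h : IsPathSeq r s t W L p) : HasPath r s t W := by
  suffices H : ∀ i ≤ L, Relation.ReflTransGen (fun u v => u ∈ W ∧ v ∈ W ∧ r u v) (p 0) (p i) from
    ⟨p 0, h.mem 0 (Nat.zero_le L), p L, h.mem L le_rfl, h.source, h.sink, H L le_rfl⟩
  intro i
  induction i with
  | zero => exact fun _ => .refl
  | succ i ih => exact fun hi =>
      (ih (by omega)).tail ⟨h.mem i (by omega), h.mem _ hi, h.step i (by omega)⟩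

theorem IsPathSeq.snoc {c d : α} (h : IsPathSeq r s (· = c) W L p) (hd : d ∈ W) (hcd : r c d) :
    IsPathSeq r s (· = d) W (L + 1) fun i => if i ≤ L then p i else d where
  mem i _ := by
    split_ifs with hi
    exacts [h.mem i hi, hd]
  source := by simpa using h.source
  sink := by simp
  step i hi := by
    rcases (Nat.lt_succ_iff.1 hi).lt_or_eq with hi | rfl
    · simpa [hi.le, Nat.succ_le_of_lt hi] using h.step i hi
    · simpa [h.sink] using hcd

theorem HasPath.exists_isPathSeq (h : HasPath r s t W) : ∃ L p, IsPathSeq r s t W L p := by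
  obtain ⟨a, ha, b, -, hs, ht, h⟩ := h
  suffices H : ∃ L p, IsPathSeq r s (· = b) W L p by
    obtain ⟨L, p, hp⟩ := H
    exact ⟨L, p, hp.mem, hp.source, hp.sink ▸ ht, hp.step⟩
  clear ht
  induction h with
  | refl => exact ⟨0, fun _ => a, fun _ _ => ha, hs, rfl, by simp⟩
  | tail _ h ih =>
    obtain ⟨L, p, hp⟩ := ih
    exact ⟨L + 1, _, hp.snoc h.2.1 h.2.2⟩

theorem IsPathSeq.shortcut (h : IsPathSeq r s t W L p) {i k : ℕ} (hk : i + 1 + k ≤ L)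
    (hr : r (p i) (p (i + 1 + k))) :
    IsPathSeq r s t W (L - k) fun j => if j ≤ i then p j else p (j + k) where
  mem j hj := by
    split_ifs
    exacts [h.mem j (by omega), h.mem _ (by omega)]
  source := by simpa using h.source
  sink := by
    rw [if_neg (by omega), Nat.sub_add_cancel (by omega)]
    exact h.sink
  step j hj := by
    rcases lt_trichotomy j i with hji | rfl | hji
    · simpa [hji.le, Nat.succ_le_of_lt hji] using h.step j (by omega)
    · simpa using hr
    · simpa [hji.not_ge, (Nat.lt_succ_of_lt hji).not_ge, Nat.add_right_comm j 1 k] using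
        h.step (j + k) (by omega)

theorem IsPathSeq.drop (h : IsPathSeq r s t W L p) {i : ℕ} (hi : i ≤ L) (hs : s (p i)) :
    IsPathSeq r s t W (L - i) fun j => p (j + i) where
  mem j hj := h.mem _ (by omega)
  source := by simpa using hs
  sink := by simpa [Nat.sub_add_cancel hi] using h.sink
  step j hj := by simpa [Nat.add_right_comm j 1 i] using h.step (j + i) (by omega)

/-- A path without chords through all the elements of `W`, of which only the first is a source. -/
structure IsChordlessPath (r : α → α → Prop) (s t : α → Prop) (W : Set α) (L : ℕ) (p : ℕ → α) :
    Prop extends IsPathSeq r s t W L p where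
  image_Iic : p '' Set.Iic L = W
  not_chord : ∀ i j, i + 1 < j → j ≤ L → ¬ r (p i) (p j)
  not_source : ∀ i ≤ L, 0 < i → ¬ s (p i)

theorem exists_isChordlessPath (hW : Minimal (HasPath r s t) W) :
    ∃ L p, IsChordlessPath r s t W L p := by
  classical
  have hex := hW.prop.exists_isPathSeq
  obtain ⟨p, hp⟩ := Nat.find_spec hex
  have hshortest : ∀ {L' q}, IsPathSeq r s t W L' q → Nat.find hex ≤ L' :=
    fun hq => Nat.find_min' hex ⟨_, hq⟩
  refine ⟨Nat.find hex, p, hp, ?_, fun i j hij hj hr => ?_, fun i hi h0 hs => ?_⟩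
  · have himage : HasPath r s t (p '' Set.Iic (Nat.find hex)) :=
      IsPathSeq.hasPath ⟨fun i hi => ⟨i, hi, rfl⟩, hp.source, hp.sink, hp.step⟩
    exact (hW.eq_of_subset himage (by rintro _ ⟨i, hi, rfl⟩; exact hp.mem i hi))
  · obtain ⟨k, rfl⟩ := Nat.exists_eq_add_of_le hij.le
    have := hshortest (hp.shortcut hj hr)
    omega
  · have := hshortest (hp.drop hi hs)
    omega

end Paths

section Stage

variable {N : ℕ}

theorem monotone_stage {φ : Set ℕ → ℕ → Prop} (hφ : Monotone φ) :
    Monotone (stage (fun X _ => φ X) N) := by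
  refine monotone_nat_of_le_succ fun t => ?_
  induction t with
  | zero => exact Set.empty_subset _
  | succ t ih => exact fun i hi => ⟨hi.1, hφ ih i hi.2⟩

theorem stage_succ_self {φ : Set ℕ → ℕ → Prop} (hφ : Monotone φ) :
    stage (fun X _ => φ X) N (N + 1) = stage (fun X _ => φ X) N N := by
  have hmono := monotone_stage (N := N) hφ
  have hfin : ∀ t, (stage (fun X _ => φ X) N t).Finite := fun t =>
    (Set.finite_Iio N).subset (stage_subset_Iio _ N t)
  have heq : ∀ t u, t ≤ u →
      (stage (fun X _ => φ X) N t).ncard = (stage (fun X _ => φ X) N u).ncard →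
      stage (fun X _ => φ X) N t = stage (fun X _ => φ X) N u := fun t u htu h =>
    Set.eq_of_subset_of_ncard_le (hmono htu) h.ge (hfin u)
  refine (heq N (N + 1) N.le_succ ?_).symm
  refine (Nat.stabilises_of_monotone (f := fun t => (stage (fun X _ => φ X) N t).ncard)
    (fun t u htu => Set.ncard_le_ncard (hmono htu) (hfin u)) (fun t => ?_) (fun t h => ?_)
    N.le_succ).symm
  · simpa using Set.ncard_le_ncard (stage_subset_Iio _ N t) (Set.finite_Iio N)
  · refine congrArg Set.ncard (?_ : {i | i < N ∧ φ (stage (fun X _ => φ X) N t) i} =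
      {i | i < N ∧ φ (stage (fun X _ => φ X) N (t + 1)) i})
    rw [heq t (t + 1) t.le_succ h]

theorem mem_stage_iff_hasPath {r : ℕ → ℕ → Prop} {s : ℕ → Prop} {W : Set ℕ} (hW : W ⊆ Set.Iio N)
    {b : ℕ} : b ∈ stage (fun X _ i => i ∈ W ∧ (s i ∨ ∃ j < N, j ∈ X ∧ r j i)) N N ↔
      HasPath r s (· = b) W := by
  set φ : Set ℕ → ℕ → Prop := fun X i => i ∈ W ∧ (s i ∨ ∃ j < N, j ∈ X ∧ r j i)
  constructor
  · suffices H : ∀ t b, b ∈ stage (fun X _ => φ X) N t → HasPath r s (· = b) W from H N b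
    intro t
    induction t with
    | zero => exact fun b hb => hb.elim
    | succ t ih =>
      rintro b ⟨-, hb, hs | ⟨j, -, hj, hr⟩⟩
      · exact ⟨b, hb, b, hb, hs, rfl, .refl⟩
      · obtain ⟨a, ha, _, hjW, hs, rfl, h⟩ := ih j hj
        exact ⟨a, ha, b, hb, hs, rfl, h.tail ⟨hjW, hb, hr⟩⟩
  · rintro ⟨a, ha, _, -, hs, rfl, h⟩
    have hfix := stage_succ_self (N := N) (φ := φ) fun X Y hXY i hi =>
      ⟨hi.1, hi.2.imp_right fun ⟨j, hj, hjX, hr⟩ => ⟨j, hj, hXY hjX, hr⟩⟩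
    change _ ∈ stage (fun X _ => φ X) N N
    induction h with
    | refl => rw [← hfix]; exact ⟨hW ha, ha, .inl hs⟩
    | tail _ h ih => rw [← hfix]; exact ⟨hW h.2.1, h.2.1, .inr ⟨_, hW h.1, ih, h.2.2⟩⟩

theorem polyDec_hasPath {Γ : Type} {R : Rep Γ} {r : Γ → ℕ → ℕ → Prop} {s t : Γ → ℕ → Prop}
    {W : Γ → Set ℕ} (hr : PolyRel R r) (hs : PolyPred R s) (ht : PolyPred R t)
    (hW : PolyPred R fun γ i => i ∈ W γ) (hlt : ∀ γ, W γ ⊆ Set.Iio (R.N γ)) :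
    PolyDec R fun γ => HasPath (r γ) (s γ) (t γ) (W γ) := by
  let φ : Γ → Set ℕ → ℕ → ℕ → Prop := fun γ X _ i =>
    i ∈ W γ ∧ (s γ i ∨ ∃ j < R.N γ, j ∈ X ∧ r γ j i)
  have hstage : PolySet R fun γ => stage (φ γ) (R.N γ) (R.N γ) := by
    refine polySet_stage fun k _ x _ y hy => ?_
    have hR := ((Extends.refl R).withArr k).withReg x
    refine ((hW.comap hR) y hy).and (((hs.comap hR) y hy).or
      (PolyPred.exists_lt_bound (R := ((R.withArr k).withReg x).withReg y)
        (ρ := fun p j => j ∈ p.1.1.2 ∧ r p.1.1.1 j p.2) fun z hz => PolyDec.and ?_ ?_))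
    · exact (polyPred_mem_snd.comap (((Extends.refl _).withReg x).withReg y)) z hz
    · exact (hr.comap ((hR.withReg y).withReg z)).app polyFun_snd
        (polyFun_snd.comap ((Extends.refl _).withReg z))
  refine (PolyPred.exists_lt_bound (ρ := fun γ b => t γ b ∧ b ∈ stage (φ γ) (R.N γ) (R.N γ))
    fun x hx => (ht x hx).and
      (hstage.polyPred (fun γ => stage_subset_Iio _ _ _) x hx)).congr fun γ => ?_
  simp only [φ, mem_stage_iff_hasPath (hlt γ)]
  constructor
  · rintro ⟨_, -, hb, a, ha, b, hbW, hs, rfl, h⟩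
    exact ⟨a, ha, b, hbW, hs, hb, h⟩
  · rintro ⟨a, ha, b, hbW, hs, hb, h⟩
    exact ⟨b, hlt γ hbW, hb, a, ha, b, hbW, hs, rfl, h⟩

/-- The set that remains of the numbers below `N` when `0, …, N - 1` are removed in turn, each of
them only if the property `P` persists. -/
def greedyMin (P : Set ℕ → Prop) (N : ℕ) : Set ℕ :=
  Set.Iio N \ stage (fun X t i => i ∈ X ∨ i = t ∧ P (Set.Iio N \ insert t X)) N N

theorem minimal_greedyMin {P : Set ℕ → Prop} (hP : Monotone P) (hN : P (Set.Iio N)) :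
    Minimal P (greedyMin P N) := by
  set D := stage (fun X t i => i ∈ X ∨ i = t ∧ P (Set.Iio N \ insert t X)) N
  have hmono : Monotone D := monotone_nat_of_le_succ fun t i hi =>
    ⟨stage_subset_Iio _ _ _ hi, .inl hi⟩
  have hprop : ∀ t, P (Set.Iio N \ D t) := by
    intro t
    induction t with
    | zero => simpa [D, stage] using hN
    | succ t ih =>
      by_cases ht : P (Set.Iio N \ insert t (D t))
      · exact hP (fun i hi => ⟨hi.1, fun hiD => hi.2 (hiD.2.symm.imp And.left id)⟩) ht
      · exact hP (fun i hi => ⟨hi.1, fun hiD => hi.2 (hiD.2.resolve_right fun h => ht h.2)⟩) ih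
  refine minimal_iff_forall_lt.2 ⟨hprop N, fun Y hY hPY => ?_⟩
  obtain ⟨t, ⟨htN, htD⟩, htY⟩ := Set.exists_of_ssubset hY
  have hsub : Y ⊆ Set.Iio N \ insert t (D t) := fun i hi =>
    ⟨(hY.1 hi).1, fun h => h.elim (fun h => htY (h ▸ hi))
      fun h => (hY.1 hi).2 (hmono (Set.mem_Iio.1 htN).le h)⟩
  exact htD (hmono (Nat.succ_le_of_lt htN) ⟨htN, .inr ⟨rfl, hP hsub hPY⟩⟩)

theorem polySet_greedyMin {Γ : Type} {R : Rep Γ} {P : Γ → Set ℕ → Prop}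
    (hP : ∀ k ≥ R.a, PolyPred (R.withArr k) fun p t =>
      P p.1 (Set.Iio (R.N p.1) \ insert t p.2)) :
    PolySet R fun γ => greedyMin (P γ) (R.N γ) := by
  have hstage := polySet_stage (R := R)
    (φ := fun γ X t i => i ∈ X ∨ i = t ∧ P γ (Set.Iio (R.N γ) \ insert t X))
    fun k hk x hx y hy => by
      have hR := (Extends.refl ((R.withArr k).withReg x)).withReg y
      refine ((polyPred_mem_snd.comap ((Extends.refl _).withReg x)) y hy).or
        ((polyFun_snd.eq (polyFun_snd.comap hR)).and ?_)
      exact ((hP k hk x hx).comap hR)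
  exact PolyPred.polySet fun x hx => (polyFun_snd.lt polyFun_bound).and
    ((hstage.polyPred fun γ => stage_subset_Iio _ _ _) x hx).not

end Stage

/-! ### Matroid intersection -/

section Intersection

open Set

variable {α : Type*} {M M₁ M₂ : Matroid α} {I J W U : Set α} {y : α}

theorem indep_insert_sdiff_singleton {x : α} (hI : M.Indep I) (hx : x ∈ I)
    (hy : y ∈ M.closure I) (hyx : y ∉ M.closure (I \ {x})) :
    M.Indep (insert y (I \ {x})) ∧ M.closure (insert y (I \ {x})) = M.closure I := by
  have hI' : M.Indep (insert y (I \ {x})) :=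
    (hI.subset sdiff_subset).insert_indep_iff.2 (.inl ⟨M.closure_subset_ground _ hy, hyx⟩)
  have hxy : x ∈ M.closure (insert y (I \ {x})) := by
    refine (Matroid.closure_exchange ⟨?_, hyx⟩).1
    rwa [insert_sdiff_singleton, insert_eq_of_mem hx]
  refine ⟨hI', Subset.antisymm ?_ ?_⟩ <;> apply M.closure_subset_closure_of_subset_closure
  · exact insert_subset hy (sdiff_subset.trans (M.subset_closure I))
  · intro a ha
    rcases eq_or_ne a x with rfl | hax
    · exact hxy
    · exact M.mem_closure_of_mem (.inr ⟨ha, hax⟩) hI'.subset_ground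

theorem image_Iio_succ (x : ℕ → α) (n : ℕ) :
    x '' Iio (n + 1) = insert (x 0) ((fun i => x (i + 1)) '' Iio n) := by
  ext a
  simp only [mem_image, mem_Iio, mem_insert_iff, Nat.exists_lt_succ_left, @eq_comm _ a]

theorem sdiff_image_union_image_Iio_succ {x y : ℕ → α} {n : ℕ}
    (h : y 0 ∉ (fun i => x (i + 1)) '' Iio n) :
    (I \ x '' Iio (n + 1)) ∪ y '' Iio (n + 1) =
      (insert (y 0) (I \ {x 0}) \ (fun i => x (i + 1)) '' Iio n) ∪
        (fun i => y (i + 1)) '' Iio n := by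
  rw [image_Iio_succ, image_Iio_succ, insert_sdiff_of_notMem _ h, sdiff_sdiff, singleton_union,
    insert_union, union_insert]

theorem mem_closure_inter_of_indep (hI : M.Indep I) (hU : U ⊆ I) (hW : W ⊆ I)
    (hyU : y ∈ M.closure U) (hyW : y ∈ M.closure W) : y ∈ M.closure (U ∩ W) :=
  (hI.subset (union_subset hU hW)).closure_inter_eq_inter_closure.ge ⟨hyU, hyW⟩

/-- Simultaneous exchange: since the matrix of the relation `y j ∉ M.closure (I \ {x i})` is
triangular, the exchanges can be carried out one after the other. -/
theorem indep_exchange (n : ℕ) (x y : ℕ → α) (hI : M.Indep I) (hx : ∀ i < n, x i ∈ I)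
    (hy : ∀ i < n, y i ∈ M.closure I) (hyI : ∀ i < n, y i ∉ I)
    (hdiag : ∀ i < n, y i ∉ M.closure (I \ {x i}))
    (hupper : ∀ i j, i < j → j < n → y j ∈ M.closure (I \ {x i})) :
    M.Indep ((I \ x '' Iio n) ∪ y '' Iio n) ∧
      M.closure ((I \ x '' Iio n) ∪ y '' Iio n) = M.closure I := by
  induction n generalizing I x y with
  | zero => simpa using hI
  | succ n ih =>
    have hx₀ := hx 0 (by omega)
    have hy₀ := hyI 0 (by omega)
    obtain ⟨hI', hcl⟩ := indep_insert_sdiff_singleton hI hx₀ (hy 0 (by omega)) (hdiag 0 (by omega))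
    set I' := insert (y 0) (I \ {x 0})
    have hsub : I \ {x 0} ⊆ I' := subset_insert _ _
    have hne : ∀ i < n, y (i + 1) ∉ M.closure (I \ {x 0} ∩ (I \ {x (i + 1)})) := fun i hi h =>
      hdiag (i + 1) (by omega) (M.closure_subset_closure inter_subset_right h)
    have hx' : ∀ i < n, x (i + 1) ∈ I \ {x 0} := fun i hi => ⟨hx _ (by omega), fun h =>
      hdiag (i + 1) (by omega) (h ▸ hupper 0 (i + 1) (by omega) (by omega))⟩
    have hyI' : ∀ i < n, y (i + 1) ∉ I' := fun i hi h => h.elim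
      (fun h => hdiag 0 (by omega) (h ▸ hupper 0 (i + 1) (by omega) (by omega)))
      fun h => hyI (i + 1) (by omega) h.1
    have hnot : y 0 ∉ (fun i => x (i + 1)) '' Iio n :=
      fun ⟨i, hi, h⟩ => hy₀ (h ▸ (hx' i hi).1)
    rw [sdiff_image_union_image_Iio_succ hnot, ← hcl]
    refine ih _ _ hI' (fun i hi => hsub (hx' i hi)) (fun i hi => hcl ▸ hy _ (by omega)) hyI'
      (fun i hi h => hne i hi ?_) fun i j hij hj => ?_
    · refine M.closure_subset_closure ?_ (mem_closure_inter_of_indep hI' hsub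
        (sdiff_subset (t := {x (i + 1)})) (hupper 0 (i + 1) (by omega) (by omega)) h)
      exact fun a ha => ⟨ha.1, ha.1.1, ha.2.2⟩
    · refine M.closure_subset_closure ?_ (mem_closure_inter_of_indep hI sdiff_subset sdiff_subset
        (hupper 0 (j + 1) (by omega) (by omega))
        (hupper (i + 1) (j + 1) (by omega) (by omega)))
      exact fun a ha => ⟨hsub ha.1, ha.2.2⟩

theorem encard_insert_of_closure_eq (hI : M.Indep I) (hJ : M.Indep J)
    (hcl : M.closure J = M.closure I) (hyE : y ∈ M.E) (hyI : y ∉ M.closure I) :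
    M.Indep (insert y J) ∧ (insert y J).encard = I.encard + 1 := by
  rw [← hcl] at hyI
  refine ⟨hJ.insert_indep_iff.2 (.inl ⟨hyE, hyI⟩), ?_⟩
  rw [encard_insert_of_notMem fun h => hyI (M.mem_closure_of_mem h hJ.subset_ground),
    hJ.isBasis_closure.encard_eq_eRk, hcl, ← hI.isBasis_closure.encard_eq_eRk]

/-- The arcs of the exchange graph of a common independent set `I`. -/
def ExchangeArc (M₁ M₂ : Matroid α) (I : Set α) (u v : α) : Prop :=
  (v ∈ I ∧ u ∈ M₂.E \ I ∧ u ∉ M₂.closure (I \ {v})) ∨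
    (u ∈ I ∧ v ∈ M₁.E \ I ∧ v ∉ M₁.closure (I \ {u}))

theorem ExchangeArc.mem_iff_notMem {u v : α} (h : ExchangeArc M₁ M₂ I u v) : v ∈ I ↔ u ∉ I := by
  rcases h with ⟨hv, hu, -⟩ | ⟨hu, hv, -⟩
  · exact iff_of_true hv hu.2
  · exact iff_of_false hv.2 (not_not.2 hu)

/-- There is a path within `W` in the exchange graph of `I` from an element that extends `I` to
an independent set of `M₁` to one that extends `I` to an independent set of `M₂`. -/
def HasAugmentingPath (M₁ M₂ : Matroid α) (I : Set α) : Set α → Prop :=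
  HasPath (ExchangeArc M₁ M₂ I) (fun y => y ∈ M₁.E \ M₁.closure I)
    (fun y => y ∈ M₂.E \ M₂.closure I)

theorem hasAugmentingPath_comm : HasAugmentingPath M₁ M₂ I = HasAugmentingPath M₂ M₁ I := by
  have hswap : ∀ M₁ M₂ : Matroid α,
      Function.swap (ExchangeArc M₁ M₂ I) = ExchangeArc M₂ M₁ I := fun _ _ => by
    ext u v
    exact or_comm
  ext W
  constructor <;> intro h <;> simpa only [HasAugmentingPath, hswap] using HasPath.swap h

theorem monotone_hasAugmentingPath : Monotone (HasAugmentingPath M₁ M₂ I) :=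
  fun _ _ hVW hV => HasPath.mono hV hVW

theorem image_Iic_two_mul (p : ℕ → α) (n : ℕ) : p '' Iic (2 * n) = insert (p 0)
    ((fun i => p (2 * i + 1)) '' Iio n ∪ (fun i => p (2 * i + 2)) '' Iio n) := by
  apply Subset.antisymm
  · rintro _ ⟨_ | i, hi, rfl⟩
    · exact .inl rfl
    · have hi : i + 1 ≤ 2 * n := hi
      rcases Nat.even_or_odd' i with ⟨k, rfl | rfl⟩
      · exact .inr (.inl ⟨k, mem_Iio.2 (by omega), rfl⟩)
      · exact .inr (.inr ⟨k, mem_Iio.2 (by omega), rfl⟩)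
  · rintro _ (rfl | ⟨i, hi : i < n, rfl⟩ | ⟨i, hi : i < n, rfl⟩)
    · exact mem_image_of_mem p (mem_Iic.2 (Nat.zero_le _))
    · exact mem_image_of_mem p (mem_Iic.2 (by omega))
    · exact mem_image_of_mem p (mem_Iic.2 (by omega))

theorem symmDiff_image_Iic_two_mul {p : ℕ → α} {n : ℕ} (hp : ∀ i ≤ 2 * n, p i ∈ I ↔ Odd i) :
    symmDiff I (p '' Iic (2 * n)) = insert (p 0) ((I \ (fun i => p (2 * i + 1)) '' Iio n) ∪
      (fun i => p (2 * i + 2)) '' Iio n) := by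
  have hp₀ : p 0 ∉ I := mt (hp 0 (Nat.zero_le _)).1 Nat.not_odd_zero
  have hodd : ∀ a ∈ (fun i => p (2 * i + 1)) '' Iio n, a ∈ I := by
    rintro _ ⟨i, hi, rfl⟩
    rw [mem_Iio] at hi
    exact (hp _ (by omega)).2 ⟨i, rfl⟩
  have heven : ∀ a ∈ (fun i => p (2 * i + 2)) '' Iio n, a ∉ I := by
    rintro _ ⟨i, hi, rfl⟩
    rw [mem_Iio] at hi
    exact mt (hp _ (by omega)).1 (Nat.not_odd_iff_even.2 ⟨i + 1, by ring⟩)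
  rw [image_Iic_two_mul]
  ext a
  simp only [mem_symmDiff, mem_insert_iff, mem_union, mem_sdiff]
  grind

theorem mem_iff_odd_of_isPathSeq {t : α → Prop} {L : ℕ} {p : ℕ → α} (hI : I ⊆ M₁.E)
    (hp : IsPathSeq (ExchangeArc M₁ M₂ I) (fun y => y ∈ M₁.E \ M₁.closure I) t W L p) :
    ∀ i ≤ L, p i ∈ I ↔ Odd i := by
  intro i
  induction i with
  | zero =>
    refine fun _ => iff_of_false (fun h => ?_) Nat.not_odd_zero
    exact hp.source.2 (M₁.mem_closure_of_mem h hI)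
  | succ i ih =>
    intro hi
    rw [(hp.step i hi).mem_iff_notMem, ih (by omega), Nat.odd_add_one]

theorem indep_symmDiff_left (h₁ : M₁.Indep I) (h₂ : I ⊆ M₂.E)
    (hW : Minimal (HasAugmentingPath M₁ M₂ I) W) :
    M₁.Indep (symmDiff I W) ∧ (symmDiff I W).encard = I.encard + 1 := by
  obtain ⟨L, p, hp⟩ := exists_isChordlessPath hW
  have halt := mem_iff_odd_of_isPathSeq h₁.subset_ground hp.toIsPathSeq
  have hL : ¬ Odd L := fun h =>
    hp.sink.2 (M₂.mem_closure_of_mem ((halt L le_rfl).2 h) h₂)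
  obtain ⟨n, rfl⟩ := (Nat.not_odd_iff_even.1 hL).two_dvd
  have hodd : ∀ i < n, p (2 * i + 1) ∈ I := fun i hi => (halt _ (by omega)).2 ⟨i, rfl⟩
  have heven : ∀ i < n, p (2 * i + 2) ∉ I := fun i hi =>
    mt (halt _ (by omega)).1 (Nat.not_odd_iff_even.2 ⟨i + 1, by ring⟩)
  have harc : ∀ i < n, p (2 * i + 2) ∈ M₁.E ∧ p (2 * i + 2) ∉ M₁.closure (I \ {p (2 * i + 1)}) := by
    intro i hi
    rcases hp.step (2 * i + 1) (by omega) with h | h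
    · exact absurd (hodd i hi) h.2.1.2
    · exact ⟨h.2.1.1, h.2.2⟩
  obtain ⟨hindep, hcl⟩ := indep_exchange n (fun i => p (2 * i + 1)) (fun i => p (2 * i + 2)) h₁
    hodd (fun i hi => by_contra fun h => hp.not_source _ (by omega) (by omega) ⟨(harc i hi).1, h⟩)
    heven (fun i hi => (harc i hi).2) fun i j hij hj => by_contra fun h =>
      hp.not_chord (2 * i + 1) (2 * j + 2) (by omega) (by omega)
        (.inr ⟨hodd i (by omega), ⟨(harc j hj).1, heven j hj⟩, h⟩)
  rw [← hp.image_Iic, symmDiff_image_Iic_two_mul halt]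
  exact encard_insert_of_closure_eq h₁ hindep hcl hp.source.1 hp.source.2

theorem mem_closure_sdiff_of_forall (hI : M.Indep I) (hy : y ∈ M.closure I)
    (h : ∀ x ∈ I ∩ U, y ∈ M.closure (I \ {x})) : y ∈ M.closure (I \ U) := by
  rcases (I ∩ U).eq_empty_or_nonempty with h₀ | h₀
  · rwa [sdiff_eq_left.2 (disjoint_iff_inter_eq_empty.2 h₀)]
  · have hinter := hI.closure_sInter_eq_biInter_closure_of_forall_subset
      (Js := (fun x => I \ {x}) '' (I ∩ U)) (h₀.image _)
      (by rintro _ ⟨x, _, rfl⟩; exact sdiff_subset)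
    refine M.closure_subset_closure (fun a ha => ?_) (hinter.ge (by simpa using h))
    simp only [sInter_image, mem_iInter] at ha
    obtain ⟨b, hb⟩ := h₀
    exact ⟨(ha b hb).1, fun haU => (ha a ⟨(ha b hb).1, haU⟩).2 rfl⟩

theorem encard_le_of_subset_closure (hJ : M.Indep J) (hJI : J ⊆ M.closure I) :
    J.encard ≤ I.encard :=
  (hJ.encard_le_eRk_of_subset hJI).trans
    ((Matroid.eRk_closure_eq _ _).le.trans (Matroid.eRk_le_encard _ _))

theorem encard_le_of_not_hasAugmentingPath (h₁ : M₁.Indep I) (h₂ : M₂.Indep I) (hW : M₁.E ⊆ W)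
    (h : ¬ HasAugmentingPath M₁ M₂ I W) (hJ₁ : M₁.Indep J) (hJ₂ : M₂.Indep J) :
    J.encard ≤ I.encard := by
  set U : Set α := {b | HasPath (ExchangeArc M₁ M₂ I) (fun y => y ∈ M₁.E \ M₁.closure I) (· = b) W}
  have hU : ∀ u ∈ U, ∀ v, ExchangeArc M₁ M₂ I u v → v ∈ U := by
    rintro _ ⟨a, ha, u, hu, hs, rfl, hau⟩ v huv
    have hv : v ∈ W := hW (huv.elim (fun h => h₁.subset_ground h.1) fun h => h.2.1.1)
    exact ⟨a, ha, v, hv, hs, rfl, hau.tail ⟨hu, hv, huv⟩⟩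
  have hin : M₂.E ∩ U ⊆ M₂.closure (I ∩ U) := by
    rintro y ⟨hyE, hyU⟩
    by_cases hyI : y ∈ I
    · exact M₂.mem_closure_of_mem' ⟨hyI, hyU⟩
    · rw [← sdiff_compl]
      refine mem_closure_sdiff_of_forall h₂ ?_ fun x hx => ?_ <;> by_contra hc
      · obtain ⟨a, ha, b, hb, hs, rfl, hab⟩ := hyU
        exact h ⟨a, ha, b, hb, hs, ⟨hyE, hc⟩, hab⟩
      · exact hx.2 (hU y hyU x (.inl ⟨hx.1, ⟨hyE, hyI⟩, hc⟩))
  have hout : M₁.E \ U ⊆ M₁.closure (I \ U) := by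
    rintro y ⟨hyE, hyU⟩
    by_cases hyI : y ∈ I
    · exact M₁.mem_closure_of_mem' ⟨hyI, hyU⟩
    · refine mem_closure_sdiff_of_forall h₁ ?_ fun x hx => ?_ <;> by_contra hc
      · exact hyU ⟨y, hW hyE, y, hW hyE, ⟨hyE, hc⟩, rfl, .refl⟩
      · exact hyU (hU x hx.2 y (.inr ⟨hx.1, ⟨hyE, hyI⟩, hc⟩))
  rw [← encard_sdiff_add_encard_inter J U, ← encard_sdiff_add_encard_inter I U]
  exact add_le_add
    (encard_le_of_subset_closure (hJ₁.subset sdiff_subset)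
      ((sdiff_subset_sdiff_left hJ₁.subset_ground).trans hout))
    (encard_le_of_subset_closure (hJ₂.subset inter_subset_left)
      ((inter_subset_inter_left _ hJ₂.subset_ground).trans hin))

/-- `I` is a common independent set of `M₁` and `M₂` of maximum size. -/
structure IsMaxCommonIndep (M₁ M₂ : Matroid α) (I : Set α) : Prop where
  indep_left : M₁.Indep I
  indep_right : M₂.Indep I
  encard_le : ∀ J, M₁.Indep J → M₂.Indep J → J.encard ≤ I.encard

theorem IsMaxCommonIndep.of_mapEmbedding {α β : Type*} {M₁ M₂ : Matroid α} {f : α ↪ β} {I : Set β}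
    (h : IsMaxCommonIndep (M₁.mapEmbedding f) (M₂.mapEmbedding f) I) :
    IsMaxCommonIndep M₁ M₂ (f ⁻¹' I) where
  indep_left := (Matroid.mapEmbedding_indep_iff.1 h.indep_left).1
  indep_right := (Matroid.mapEmbedding_indep_iff.1 h.indep_right).1
  encard_le J hJ₁ hJ₂ := by
    have hI : f '' (f ⁻¹' I) = I :=
      image_preimage_eq_of_subset (Matroid.mapEmbedding_indep_iff.1 h.indep_left).2
    rw [← f.injective.encard_image J, ← f.injective.encard_image (f ⁻¹' I), hI]
    exact h.encard_le _ (hJ₁.mapEmbedding f) (hJ₂.mapEmbedding f)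

end Intersection

section MaxCommonIndep

open Set

variable {M₁ M₂ : Matroid ℕ} {I : Set ℕ} {N : ℕ}

/-- The common independent set `I` after the augmentation along a path of the exchange graph if
there is one, and `I` itself otherwise. -/
def augment (M₁ M₂ : Matroid ℕ) (N : ℕ) (I : Set ℕ) : Set ℕ :=
  symmDiff I {i | HasAugmentingPath M₁ M₂ I (Iio N) ∧ i ∈ greedyMin (HasAugmentingPath M₁ M₂ I) N}

theorem augment_of_not_hasAugmentingPath (h : ¬ HasAugmentingPath M₁ M₂ I (Iio N)) :
    augment M₁ M₂ N I = I := by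
  simp [augment, h]

theorem augment_of_hasAugmentingPath (h₁ : M₁.Indep I) (h₂ : M₂.Indep I)
    (h : HasAugmentingPath M₁ M₂ I (Iio N)) :
    M₁.Indep (augment M₁ M₂ N I) ∧ M₂.Indep (augment M₁ M₂ N I) ∧
      (augment M₁ M₂ N I).encard = I.encard + 1 := by
  have hmin := minimal_greedyMin monotone_hasAugmentingPath h
  simp only [augment, h, true_and, ofPred_mem_eq]
  obtain ⟨hindep, hcard⟩ := indep_symmDiff_left h₁ h₂.subset_ground hmin
  rw [hasAugmentingPath_comm] at hmin ⊢
  exact ⟨by rwa [hasAugmentingPath_comm], (indep_symmDiff_left h₂ h₁.subset_ground hmin).1,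
    by rwa [hasAugmentingPath_comm]⟩

/-- The common independent set that is obtained from the empty set by `N` augmentations. -/
def maxCommonIndep (M₁ M₂ : Matroid ℕ) (N : ℕ) : Set ℕ :=
  stage (fun I _ i => i ∈ augment M₁ M₂ N I) N N

theorem isMaxCommonIndep_maxCommonIndep (hE₁ : M₁.E ⊆ Iio N) :
    IsMaxCommonIndep M₁ M₂ (maxCommonIndep M₁ M₂ N) := by
  suffices H : ∀ t, ∃ I, stage (fun I _ i => i ∈ augment M₁ M₂ N I) N t = I ∧
      M₁.Indep I ∧ M₂.Indep I ∧ (t ≤ I.encard ∨ ¬ HasAugmentingPath M₁ M₂ I (Iio N)) by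
    obtain ⟨I, hI, h₁, h₂, hN⟩ := H N
    rw [maxCommonIndep, hI]
    refine ⟨h₁, h₂, fun J hJ₁ hJ₂ => hN.elim (fun hN => ?_) fun hN =>
      encard_le_of_not_hasAugmentingPath h₁ h₂ hE₁ hN hJ₁ hJ₂⟩
    exact (encard_le_encard (hJ₁.subset_ground.trans hE₁)).trans
      (by simpa [encard_eq_coe_toFinset_card] using hN)
  intro t
  induction t with
  | zero => exact ⟨∅, rfl, M₁.empty_indep, M₂.empty_indep, by simp⟩
  | succ t ih =>
    obtain ⟨I, hI, h₁, h₂, ht⟩ := ih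
    have hstage : M₁.Indep (augment M₁ M₂ N I) →
        stage (fun I _ i => i ∈ augment M₁ M₂ N I) N (t + 1) = augment M₁ M₂ N I := fun h => by
      rw [stage, hI]
      exact inter_eq_right.2 (h.subset_ground.trans hE₁)
    by_cases h : HasAugmentingPath M₁ M₂ I (Iio N)
    · obtain ⟨h₁', h₂', hcard⟩ := augment_of_hasAugmentingPath h₁ h₂ h
      refine ⟨_, hstage h₁', h₁', h₂', .inl ?_⟩
      rw [hcard]
      exact_mod_cast add_le_add_left (ht.resolve_right (not_not.2 h)) 1
    · rw [augment_of_not_hasAugmentingPath h] at hstage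
      exact ⟨I, hstage h₁, h₁, h₂, .inr h⟩

end MaxCommonIndep

section PolyMatroid

open Set

variable {Γ Δ : Type} {R : Rep Γ} {R' : Rep Δ} {g : Δ → Γ} {M M₁ M₂ : Γ → Matroid ℕ}
  {I X W : Γ → Set ℕ}

/-- The ground set of the matroid `M γ` consists of numbers below the bound, and membership in it
and in the closure of a set that is kept in an array is decidable in polynomial time. -/
structure PolyMatroid (R : Rep Γ) (M : Γ → Matroid ℕ) : Prop where
  ground_subset : ∀ γ, (M γ).E ⊆ Iio (R.N γ)
  mem_ground : PolyPred R fun γ i => i ∈ (M γ).E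
  mem_closure_snd : ∀ k ≥ R.a, PolyPred (R.withArr k) fun p i => i ∈ (M p.1).closure p.2

namespace PolyMatroid

theorem comap (hM : PolyMatroid R M) (hR : Extends R' R g) :
    PolyMatroid R' fun δ => M (g δ) where
  ground_subset δ := hR.N_eq δ ▸ hM.ground_subset (g δ)
  mem_ground := hM.mem_ground.comap hR
  mem_closure_snd k hk :=
    (hM.mem_closure_snd k (hR.a_le.trans hk)).comap (hR.withArr_withArr k)

theorem mem_closure (hM : PolyMatroid R M) (hX : PolyPred R fun γ i => i ∈ X γ) :
    PolyPred R fun γ i => i ∈ (M γ).closure (X γ) := by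
  have hXN : PolyPred R fun γ i => i ∈ X γ ∩ Iio (R.N γ) := fun x hx =>
    (hX x hx).and (polyFun_snd.lt polyFun_bound)
  have hcl := PolyPred.appSet (ρ := fun γ X i => i ∈ (M γ).closure X) hM.mem_closure_snd
    hXN.polySet fun _ => inter_subset_right
  have heq : ∀ γ, (M γ).closure (X γ ∩ Iio (R.N γ)) = (M γ).closure (X γ) := fun γ => by
    rw [← (M γ).closure_inter_ground, inter_assoc,
      inter_eq_self_of_subset_right (hM.ground_subset γ), (M γ).closure_inter_ground]
  simpa only [heq] using hcl

theorem mem_ground_sdiff_closure (hM : PolyMatroid R M) (hX : PolyPred R fun γ i => i ∈ X γ) :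
    PolyPred R fun γ i => i ∈ (M γ).E \ (M γ).closure (X γ) :=
  fun x hx => (hM.mem_ground x hx).and (hM.mem_closure hX x hx).not

theorem exchangeArc (h₁ : PolyMatroid R M₁) (h₂ : PolyMatroid R M₂)
    (hI : PolyPred R fun γ i => i ∈ I γ) :
    PolyRel R fun γ => ExchangeArc (M₁ γ) (M₂ γ) (I γ) := by
  intro x _ y _
  have hR := ((Extends.refl R).withReg x).withReg y
  have hu : PolyFun ((R.withReg x).withReg y) fun p => p.1.2 :=
    polyFun_snd.comap ((Extends.refl _).withReg y)
  have hv : PolyFun ((R.withReg x).withReg y) fun p => p.2 := polyFun_snd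
  have hside : ∀ {M : Γ → Matroid ℕ} {f h : (Γ × ℕ) × ℕ → ℕ}, PolyMatroid R M →
      PolyFun ((R.withReg x).withReg y) f → PolyFun ((R.withReg x).withReg y) h →
      PolyDec ((R.withReg x).withReg y) fun p => f p ∈ I p.1.1 ∧ h p ∈ (M p.1.1).E \ I p.1.1 ∧
        h p ∉ (M p.1.1).closure (I p.1.1 \ {f p}) := by
    intro M f h hM hf hh
    have hdiff : PolyPred ((R.withReg x).withReg y) fun p i => i ∈ I p.1.1 \ {f p} := fun z hz =>
      ((hI.comap hR) z hz).and (polyFun_snd.eq (hf.comap ((Extends.refl _).withReg z))).not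
    exact ((hI.comap hR).app hf).and <|
      (((hM.mem_ground.comap hR).app hh).and ((hI.comap hR).app hh).not).and
        (((hM.comap hR).mem_closure hdiff).app hh).not
  exact (hside h₂ hv hu).or (hside h₁ hu hv)

theorem hasAugmentingPath (h₁ : PolyMatroid R M₁) (h₂ : PolyMatroid R M₂)
    (hI : PolyPred R fun γ i => i ∈ I γ) (hW : PolyPred R fun γ i => i ∈ W γ)
    (hlt : ∀ γ, W γ ⊆ Iio (R.N γ)) :
    PolyDec R fun γ => HasAugmentingPath (M₁ γ) (M₂ γ) (I γ) (W γ) :=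
  polyDec_hasPath (h₁.exchangeArc h₂ hI) (h₁.mem_ground_sdiff_closure hI)
    (h₂.mem_ground_sdiff_closure hI) hW hlt

theorem mem_augment (h₁ : PolyMatroid R M₁) (h₂ : PolyMatroid R M₂)
    (hI : PolyPred R fun γ i => i ∈ I γ) :
    PolyPred R fun γ i => i ∈ augment (M₁ γ) (M₂ γ) (R.N γ) (I γ) := by
  have hIio : PolyPred R fun γ i => i ∈ Iio (R.N γ) := fun x _ => polyFun_snd.lt polyFun_bound
  have hpath : PolySet R fun γ =>
      greedyMin (HasAugmentingPath (M₁ γ) (M₂ γ) (I γ)) (R.N γ) := by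
    refine polySet_greedyMin fun k _ x _ => ?_
    have hR := ((Extends.refl R).withArr k).withReg x
    refine (h₁.comap hR).hasAugmentingPath (h₂.comap hR) (hI.comap hR)
      (W := fun q => Iio (R.N q.1.1) \ insert q.2 q.1.2) (fun y hy => ?_)
      fun _ => sdiff_subset
    exact ((hIio.comap hR) y hy).and (((polyFun_snd.eq
      (polyFun_snd.comap ((Extends.refl _).withReg y))).or
      ((polyPred_mem_snd.comap ((Extends.refl _).withReg x)) y hy)).not)
  intro x hx
  have hR := (Extends.refl R).withReg x
  have hflip := ((h₁.hasAugmentingPath h₂ hI hIio fun _ => subset_rfl).comap hR).and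
    (hpath.polyPred (fun _ => sdiff_subset) x hx)
  exact ((hI x hx).and hflip.not).or (hflip.and (hI x hx).not)

theorem mem_maxCommonIndep (h₁ : PolyMatroid R M₁) (h₂ : PolyMatroid R M₂) :
    PolyPred R fun γ i => i ∈ maxCommonIndep (M₁ γ) (M₂ γ) (R.N γ) :=
  PolySet.polyPred (polySet_stage fun k _ x _ =>
    have hR := ((Extends.refl R).withArr k).withReg x
    (h₁.comap hR).mem_augment (h₂.comap hR)
      (polyPred_mem_snd.comap ((Extends.refl _).withReg x))) fun _ => stage_subset_Iio _ _ _

end PolyMatroid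

end PolyMatroid

/-! ### Linear matroids -/

section LinearMatroid

open Set Submodule

variable {α K M : Type*} [DivisionRing K] [AddCommGroup M] [Module K M] {v : α → M}
  {E X Y : Set α}

theorem ncard_le_of_subset_span (hY : LinearIndepOn K v Y) (hYf : Y.Finite) (hX : X.Finite)
    (hsub : v '' Y ⊆ span K (v '' X)) : Y.ncard ≤ X.ncard := by
  have := hYf.fintype
  have := (hX.image v).fintype
  rw [image_eq_range] at hsub
  have hcard := linearIndependent_le_span_aux' _ hY _ hsub
  rw [← Nat.card_eq_fintype_card, ← Nat.card_eq_fintype_card] at hcard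
  exact hcard.trans (ncard_image_le hX)

theorem exists_linearIndepOn_insert (hX : LinearIndepOn K v X) (hXf : X.Finite)
    (hY : LinearIndepOn K v Y) (hYf : Y.Finite) (hlt : X.ncard < Y.ncard) :
    ∃ e ∈ Y, e ∉ X ∧ LinearIndepOn K v (insert e X) := by
  obtain ⟨_, ⟨e, heY, rfl⟩, he⟩ : ∃ w ∈ v '' Y, w ∉ span K (v '' X) :=
    not_subset.1 fun hsub => hlt.not_ge (ncard_le_of_subset_span hY hYf hXf hsub)
  exact ⟨e, heY, fun heX => he (subset_span (mem_image_of_mem v heX)), hX.insert he⟩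

variable (K v E) in
/-- The matroid on `E` whose independent sets index linearly independent vectors `v e`. -/
def linearMatroid : Matroid α :=
  (IndepMatroid.ofFinitaryCardAugment E (fun X => X ⊆ E ∧ LinearIndepOn K v X)
    ⟨empty_subset E, linearIndepOn_empty K v⟩
    (fun _ _ hY hXY => ⟨hXY.trans hY.1, hY.2.mono hXY⟩)
    (fun _ _ hX hXf hY hYf hlt => by
      obtain ⟨e, heY, heX, he⟩ := exists_linearIndepOn_insert hX.2 hXf hY.2 hYf hlt
      exact ⟨e, heY, heX, insert_subset (hY.1 heY) hX.1, he⟩)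
    (fun _ h => ⟨fun e he => (h {e} (singleton_subset_iff.2 he) (finite_singleton e)).1 rfl,
      linearIndepOn_of_finite _ fun Y hY hYf => (h Y hY hYf).2⟩)
    (fun _ h => h.1)).matroid

@[simp]
theorem linearMatroid_ground : (linearMatroid K v E).E = E := rfl

theorem linearMatroid_indep_iff :
    (linearMatroid K v E).Indep X ↔ X ⊆ E ∧ LinearIndepOn K v X := Iff.rfl

theorem mem_closure_linearMatroid_of_indep (hX : (linearMatroid K v E).Indep X) {e : α} :
    e ∈ (linearMatroid K v E).closure X ↔ e ∈ E ∧ v e ∈ span K (v '' X) := by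
  rw [hX.mem_closure_iff', linearMatroid_ground, hX.2.mem_span_iff, linearMatroid_indep_iff]
  refine and_congr_right fun he => ?_
  rw [insert_subset_iff, and_iff_right ⟨he, hX.1⟩]

theorem mem_closure_linearMatroid {e : α} :
    e ∈ (linearMatroid K v E).closure X ↔ e ∈ E ∧ v e ∈ span K (v '' (X ∩ E)) := by
  obtain ⟨I, hI⟩ := (linearMatroid K v E).exists_isBasis (X ∩ E) inter_subset_right
  have hspan : span K (v '' I) = span K (v '' (X ∩ E)) := by
    refine (span_mono (image_mono hI.subset)).antisymm (span_le.2 ?_)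
    rintro _ ⟨f, hf, rfl⟩
    exact ((mem_closure_linearMatroid_of_indep hI.indep).1 (hI.subset_closure hf)).2
  rw [← (linearMatroid K v E).closure_inter_ground, linearMatroid_ground,
    ← hI.closure_eq_closure, mem_closure_linearMatroid_of_indep hI.indep, hspan]

end LinearMatroid

/-! ### Graphic matroids -/

section Acyclic

open SimpleGraph

variable {W : Type*} {A : Set (Sym2 W)} {x y : W}

theorem reachable_fromEdgeSet_of_mem (h : s(x, y) ∈ A) : (fromEdgeSet A).Reachable x y := by
  rw [reachable_fromEdgeSet_eq_reflTransGen_toRel]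
  exact .single h

theorem connected_iff_ncard_edgeSet_of_isAcyclic [Finite W] {G : SimpleGraph W}
    (hG : G.IsAcyclic) : G.Connected ↔ G.edgeSet.ncard + 1 = Nat.card W := by
  refine ⟨fun hc => (isTree_iff_connected_and_card.1 ⟨hc, hG⟩).2, fun hcard => ?_⟩
  have : Nonempty W := (Nat.card_pos_iff.1 (by omega)).1
  obtain ⟨T, hGT, -, hT⟩ :=
    (connected_top (V := W)).exists_isTree_le_of_le_of_isAcyclic le_top hG
  have hTcard : T.edgeSet.ncard + 1 = Nat.card W := (isTree_iff_connected_and_card.1 hT).2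
  have hedge : G.edgeSet = T.edgeSet :=
    Set.eq_of_subset_of_ncard_le (edgeSet_mono hGT) (by omega) (Set.toFinite _)
  exact edgeSet_inj.1 hedge ▸ hT.connected

end Acyclic

section Graphic

open Set Submodule SimpleGraph

variable {α W : Type*} {ends : α → Sym2 W} {E X Y : Set α} {A : Set (Sym2 W)} {x y : W}

/-- The column of an edge in the incidence matrix over the field with two elements; over this
field no orientation of the edges has to be chosen. -/
noncomputable def incidence : Sym2 W → W →₀ ZMod 2 :=
  Sym2.lift ⟨fun x y => Finsupp.single x 1 + Finsupp.single y 1, fun _ _ => add_comm _ _⟩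

theorem incidence_mk (x y : W) :
    incidence s(x, y) = Finsupp.single x 1 + Finsupp.single y 1 := rfl

theorem incidence_self (x : W) : incidence s(x, x) = 0 := by
  rw [incidence_mk, ← Finsupp.single_add, CharTwo.add_self_eq_zero, Finsupp.single_zero]

theorem incidence_add_incidence (x y z : W) :
    incidence s(x, y) + incidence s(y, z) = incidence s(x, z) := by
  have hy := incidence_self y
  rw [incidence_mk] at hy
  rw [incidence_mk, incidence_mk, add_assoc, ← add_assoc (Finsupp.single y 1), hy, zero_add,
    incidence_mk]

theorem incidence_mem_span_of_reachable (h : (fromEdgeSet A).Reachable x y) :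
    incidence s(x, y) ∈ span (ZMod 2) (incidence '' A) := by
  rw [reachable_fromEdgeSet_eq_reflTransGen_toRel] at h
  induction h with
  | refl => exact incidence_self x ▸ zero_mem _
  | tail _ hyz ih =>
    exact incidence_add_incidence x _ _ ▸ add_mem ih (subset_span (mem_image_of_mem _ hyz))

-- The functional that sums the coordinates over the component of `x` vanishes on the columns of
-- the edges in `A`, but not on that of an edge that leaves the component.
theorem reachable_of_incidence_mem_span
    (h : incidence s(x, y) ∈ span (ZMod 2) (incidence '' A)) :
    (fromEdgeSet A).Reachable x y := by
  classical
  let c : W → ZMod 2 := fun w => if (fromEdgeSet A).Reachable x w then 1 else 0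
  let φ := Finsupp.linearCombination (ZMod 2) c
  have hφ : ∀ u v, φ (incidence s(u, v)) = c u + c v := fun u v => by
    simp [φ, incidence_mk]
  have hker : span (ZMod 2) (incidence '' A) ≤ LinearMap.ker φ := by
    rw [span_le, image_subset_iff]
    intro e he
    induction e with | h u v =>
    have huv : (fromEdgeSet A).Reachable u v := reachable_fromEdgeSet_of_mem he
    have hc : c u = c v := if_congr ⟨fun h => h.trans huv, fun h => h.trans huv.symm⟩ rfl rfl
    exact LinearMap.mem_ker.2 (by rw [hφ, hc, CharTwo.add_self_eq_zero])
  by_contra hxy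
  have hzero := LinearMap.mem_ker.1 (hker h)
  simp [hφ, c, hxy] at hzero

theorem incidence_mem_span_iff :
    incidence s(x, y) ∈ span (ZMod 2) (incidence '' A) ↔ (fromEdgeSet A).Reachable x y :=
  ⟨reachable_of_incidence_mem_span, incidence_mem_span_of_reachable⟩

theorem isForest_iff_linearIndepOn :
    IsForest ends X ↔ LinearIndepOn (ZMod 2) (incidence ∘ ends) X := by
  simp only [linearIndepOn_iff_notMem_span, IsForest, ← incidence_mem_span_iff, image_image,
    Function.comp_apply]
  refine forall₂_congr fun e _ => ?_
  induction ends e with | h x y =>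
  exact ⟨fun h => h x y rfl, fun h x' y' hxy => hxy ▸ h⟩

variable (ends E) in
/-- The graphic matroid of the multigraph with the edges `E` and their ends `ends`, represented
by its incidence matrix. -/
noncomputable def graphicMatroid : Matroid α := linearMatroid (ZMod 2) (incidence ∘ ends) E

@[simp]
theorem graphicMatroid_ground : (graphicMatroid ends E).E = E := rfl

theorem graphicMatroid_indep_iff :
    (graphicMatroid ends E).Indep X ↔ X ⊆ E ∧ IsForest ends X := by
  rw [isForest_iff_linearIndepOn, graphicMatroid, linearMatroid_indep_iff]

theorem isGraphicMatroidOf_graphicMatroid : IsGraphicMatroidOf (graphicMatroid ends E) ends :=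
  fun _ => graphicMatroid_indep_iff

theorem mem_closure_graphicMatroid {e : α} (he : ends e = s(x, y)) :
    e ∈ (graphicMatroid ends E).closure X ↔
      e ∈ E ∧ (fromEdgeSet (ends '' (X ∩ E))).Reachable x y := by
  rw [graphicMatroid, mem_closure_linearMatroid, Function.comp_apply, he, image_comp,
    incidence_mem_span_iff]

theorem IsForest.injOn (h : IsForest ends X) : InjOn ends X := by
  intro e he f hf hef
  by_contra hne
  induction hxy : ends e with | h x y =>
  exact h e he x y hxy
    (reachable_fromEdgeSet_of_mem ⟨f, ⟨hf, fun hfe => hne hfe.symm⟩, hef ▸ hxy⟩)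

theorem IsForest.not_isDiag (h : IsForest ends X) {e : α} (he : e ∈ X) :
    ¬ (ends e).IsDiag := by
  induction hxy : ends e with | h x y =>
  rintro (rfl : x = y)
  exact h e he x x hxy .rfl

theorem deleteEdges_fromEdgeSet_image (hinj : InjOn ends X) {e : α} (he : e ∈ X) :
    (fromEdgeSet (ends '' X)).deleteEdges {ends e} = fromEdgeSet (ends '' (X \ {e})) := by
  rw [← image_singleton, deleteEdges_fromEdgeSet,
    hinj.image_sdiff_subset (singleton_subset_iff.2 he)]

theorem isForest_iff_isAcyclic (hinj : InjOn ends X) (hdiag : ∀ e ∈ X, ¬ (ends e).IsDiag) :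
    IsForest ends X ↔ (fromEdgeSet (ends '' X)).IsAcyclic := by
  rw [isAcyclic_iff_forall_adj_isBridge]
  constructor
  · intro h x y hxy
    obtain ⟨⟨e, he, hex⟩, -⟩ := (fromEdgeSet_adj _).1 hxy
    rw [isBridge_iff, ← hex, deleteEdges_fromEdgeSet_image hinj he]
    exact h e he x y hex
  · intro h e he x y hxy
    have hne : x ≠ y := fun hne => hdiag e he (hxy ▸ hne)
    have hbridge := isBridge_iff.1 (h ((fromEdgeSet_adj _).2 ⟨⟨e, he, hxy⟩, hne⟩))
    rwa [← hxy, deleteEdges_fromEdgeSet_image hinj he] at hbridge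

theorem IsForest.connected_iff_ncard [Finite W] (h : IsForest ends X) :
    (fromEdgeSet (ends '' X)).Connected ↔ X.ncard + 1 = Nat.card W := by
  have hdiag : ∀ e ∈ X, ¬ (ends e).IsDiag := fun _ => h.not_isDiag
  have hedge : (fromEdgeSet (ends '' X)).edgeSet = ends '' X := by
    rw [edgeSet_fromEdgeSet, sdiff_eq_left, Set.disjoint_left]
    rintro _ ⟨e, he, rfl⟩
    exact hdiag e he
  rw [connected_iff_ncard_edgeSet_of_isAcyclic ((isForest_iff_isAcyclic h.injOn hdiag).1 h),
    hedge, h.injOn.ncard_image]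

theorem connected_of_subset_closure_graphicMatroid
    (hXY : X ⊆ (graphicMatroid ends E).closure Y) (hX : (fromEdgeSet (ends '' X)).Connected) :
    (fromEdgeSet (ends '' Y)).Connected := by
  have := hX.nonempty
  refine ⟨fun x y => ?_⟩
  have hxy := hX.preconnected x y
  rw [reachable_fromEdgeSet_eq_reflTransGen_toRel] at hxy
  induction hxy with
  | refl => exact .rfl
  | tail _ hyz ih =>
    obtain ⟨e, he, hends⟩ := hyz
    have hr := ((mem_closure_graphicMatroid hends).1 (hXY he)).2
    exact ih.trans (hr.mono (fromEdgeSet_mono (image_mono inter_subset_left)))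

end Graphic

/-! ### Contraction of connected components -/

section Contraction

open SimpleGraph

variable {V : Type*} {H : SimpleGraph V} {A : Set (Sym2 V)} {x y : V}

theorem reachable_contract_of_reachable (h : (H ⊔ fromEdgeSet A).Reachable x y) :
    (fromEdgeSet (Sym2.map H.connectedComponentMk '' A)).Reachable
      (H.connectedComponentMk x) (H.connectedComponentMk y) := by
  rw [reachable_iff_reflTransGen] at h
  induction h with
  | refl => exact .rfl
  | tail _ hyz ih =>
    refine ih.trans ?_
    rcases hyz with hyz | hyz
    · rw [ConnectedComponent.sound hyz.reachable]
    · exact reachable_fromEdgeSet_of_mem ⟨_, ((fromEdgeSet_adj A).1 hyz).1, rfl⟩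

theorem reachable_of_reachable_contract
    (h : (fromEdgeSet (Sym2.map H.connectedComponentMk '' A)).Reachable
      (H.connectedComponentMk x) (H.connectedComponentMk y)) :
    (H ⊔ fromEdgeSet A).Reachable x y := by
  let q : H.ConnectedComponent → (H ⊔ fromEdgeSet A).ConnectedComponent :=
    ConnectedComponent.map (Hom.ofLE le_sup_left)
  have hq : ∀ c d, s(c, d) ∈ Sym2.map H.connectedComponentMk '' A → q c = q d := by
    rintro c d ⟨e, he, hcd⟩
    induction e with | h u v =>
    have huv : q (H.connectedComponentMk u) = q (H.connectedComponentMk v) :=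
      ConnectedComponent.sound ((reachable_fromEdgeSet_of_mem he).mono le_sup_right)
    rcases Sym2.eq_iff.1 hcd with ⟨rfl, rfl⟩ | ⟨rfl, rfl⟩
    exacts [huv, huv.symm]
  rw [reachable_fromEdgeSet_eq_reflTransGen_toRel] at h
  exact ConnectedComponent.exact
    (Relation.reflTransGen_le_of_equivalence_of_le (Setoid.ker q).iseqv hq _ _ h)

theorem connected_contract_iff :
    (fromEdgeSet (Sym2.map H.connectedComponentMk '' A)).Connected ↔
      (H ⊔ fromEdgeSet A).Connected := by
  rw [connected_iff, connected_iff]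
  refine and_congr ⟨fun h x y => reachable_of_reachable_contract (h _ _), fun h c d => ?_⟩
    ⟨fun ⟨c⟩ => c.ind fun v => ⟨v⟩, fun ⟨v⟩ => ⟨H.connectedComponentMk v⟩⟩
  induction c using ConnectedComponent.ind with | h x =>
  induction d using ConnectedComponent.ind with | h y =>
  exact reachable_contract_of_reachable (h x y)

end Contraction

/-! ### Dependencies along paths of length at most one -/

section Dependencies

open Set SimpleGraph

variable {E : Type*} {D : Digraph E} {a b x y : E}

theorem reachable_of_digraph_adj (h : D.Adj x y) : D.toSimpleGraphInclusive.Reachable x y := by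
  rcases eq_or_ne x y with rfl | hne
  · exact .rfl
  · exact Adj.reachable ⟨hne, .inl h⟩

namespace ComponentsArePathsOfLengthLEOne

theorem ne_of_adj (hD : ComponentsArePathsOfLengthLEOne D) (h : D.Adj a b) : a ≠ b := by
  rintro rfl
  have ha : a ∈ (D.toSimpleGraphInclusive.connectedComponentMk a).supp := rfl
  rcases hD (D.toSimpleGraphInclusive.connectedComponentMk a) with ⟨e, hs, he⟩ | ⟨e, f, hef, -, he⟩
  · rw [hs, mem_singleton_iff] at ha
    exact he (ha ▸ h)
  · obtain ⟨hae, haf⟩ := (he a ha a ha).1 h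
    exact hef (hae.symm.trans haf)

theorem eq_of_adj_of_reachable (hD : ComponentsArePathsOfLengthLEOne D) (hab : D.Adj a b)
    (hxy : D.Adj x y) (hax : D.toSimpleGraphInclusive.Reachable a x) : a = x ∧ b = y := by
  have ha : a ∈ (D.toSimpleGraphInclusive.connectedComponentMk a).supp := rfl
  have hb := ConnectedComponent.sound (reachable_of_digraph_adj hab).symm
  have hx := ConnectedComponent.sound hax.symm
  have hy := (ConnectedComponent.sound (reachable_of_digraph_adj hxy).symm).trans hx
  rcases hD (D.toSimpleGraphInclusive.connectedComponentMk a) with ⟨e, hs, -⟩ | ⟨e, f, -, -, he⟩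
  · have hae : a = e := by rwa [hs] at ha
    have hbe : b ∈ ({e} : Set E) := hs ▸ hb
    exact absurd (hae.trans hbe.symm) (hD.ne_of_adj hab)
  · obtain ⟨rfl, rfl⟩ := (he a ha b hb).1 hab
    obtain ⟨rfl, rfl⟩ := (he x hx y hy).1 hxy
    exact ⟨rfl, rfl⟩

theorem adj_left_unique (hD : ComponentsArePathsOfLengthLEOne D) (hab : D.Adj a b)
    (hxb : D.Adj x b) : a = x :=
  (hD.eq_of_adj_of_reachable hab hxb
    ((reachable_of_digraph_adj hab).trans (reachable_of_digraph_adj hxb).symm)).1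

theorem adj_right_unique (hD : ComponentsArePathsOfLengthLEOne D) (hab : D.Adj a b)
    (hay : D.Adj a y) : b = y :=
  (hD.eq_of_adj_of_reachable hab hay .rfl).2

theorem not_adj_of_adj (hD : ComponentsArePathsOfLengthLEOne D) (hab : D.Adj a b) :
    ¬ D.Adj b y := fun hby =>
  hD.ne_of_adj hab (hD.eq_of_adj_of_reachable hab hby (reachable_of_digraph_adj hab)).1

end ComponentsArePathsOfLengthLEOne

end Dependencies

/-! ### Feasibility -/

section Feasibility

open Set SimpleGraph

variable {V : Type*} {G : SimpleGraph V} {D : Digraph G.edgeSet} {X Y : Set G.edgeSet}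
  {e f : G.edgeSet} {x y : V}

theorem mem_depSet : f ∈ depSet D X ↔ ∃ e ∈ X, f ∈ dep D e := by
  simp only [depSet, mem_iUnion, exists_prop]

theorem depSet_mono (h : X ⊆ Y) : depSet D X ⊆ depSet D Y := biUnion_mono h fun _ _ => le_rfl

theorem depSet_inter_dependentEdges : depSet D (X ∩ dependentEdges D) = depSet D X := by
  refine (depSet_mono inter_subset_left).antisymm fun f hf => ?_
  obtain ⟨e, he, hfe⟩ := mem_depSet.1 hf
  exact mem_depSet.2 ⟨e, ⟨he, f, hfe⟩, hfe⟩

theorem depSet_subset_compl_dependentEdges (hD : ComponentsArePathsOfLengthLEOne D) :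
    depSet D X ⊆ (dependentEdges D)ᶜ := by
  rintro f hf ⟨g, hg⟩
  obtain ⟨e, -, hfe⟩ := mem_depSet.1 hf
  exact hD.not_adj_of_adj hg hfe

/-- The spanning subgraph of `G` with the edge set `X`. -/
def edgeGraph (X : Set G.edgeSet) : SimpleGraph V := fromEdgeSet (Subtype.val '' X)

theorem edgeSet_edgeGraph : (edgeGraph X).edgeSet = Subtype.val '' X := by
  rw [edgeGraph, edgeSet_fromEdgeSet, sdiff_eq_left, Set.disjoint_left]
  rintro _ ⟨e, -, rfl⟩
  exact G.not_isDiag_of_mem_edgeSet e.2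

theorem edgeGraph_le_iff : edgeGraph X ≤ edgeGraph Y ↔ X ⊆ Y := by
  rw [← edgeSet_subset_edgeSet, edgeSet_edgeGraph, edgeSet_edgeGraph,
    image_subset_image_iff Subtype.val_injective]

theorem edgeGraph_union : edgeGraph (X ∪ Y) = edgeGraph X ⊔ edgeGraph Y := by
  rw [edgeGraph, image_union, fromEdgeSet_union, edgeGraph, edgeGraph]

theorem edgeGraph_le : edgeGraph X ≤ G := by
  rw [← edgeSet_subset_edgeSet, edgeSet_edgeGraph]
  exact Subtype.coe_image_subset _ _

theorem exists_edgeGraph_eq {T : SimpleGraph V} (hT : T ≤ G) :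
    ∃ Y : Set G.edgeSet, edgeGraph Y = T := by
  obtain ⟨Y, hY⟩ := subset_range_iff_exists_image_eq.1
    ((edgeSet_mono hT).trans Subtype.range_coe.superset)
  exact ⟨Y, by rw [edgeGraph, hY, fromEdgeSet_edgeSet]⟩

theorem baseGraph_eq_edgeGraph : baseGraph D = edgeGraph (dependentEdges D)ᶜ := by
  rw [← edgeSet_inj, edgeSet_edgeGraph, baseGraph, edgeSet_deleteEdges,
    image_compl_eq_range_sdiff_image Subtype.val_injective, Subtype.range_coe]

theorem satisfies_edgeGraph_iff [Finite V] {ℓ u : G.edgeSet → ℕ}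
    (h : ∀ e, ℓ e = u e ∧ u e = (dep D e).ncard) :
    Satisfies D ℓ u (edgeGraph Y) ↔ depSet D Y ⊆ Y := by
  have hmem : ∀ e : G.edgeSet, (e : Sym2 V) ∈ (edgeGraph Y).edgeSet ↔ e ∈ Y := fun e => by
    rw [edgeSet_edgeGraph, Subtype.val_injective.mem_set_image]
  simp only [Satisfies, hmem, ofPred_mem_eq, depSet, iUnion_subset_iff]
  refine forall₂_congr fun e _ => ?_
  rw [(h e).1, (h e).2, and_iff_left (ncard_le_ncard inter_subset_left), ← inter_eq_left]
  exact ⟨eq_of_subset_of_ncard_le inter_subset_left, fun hdep => hdep.symm ▸ le_rfl⟩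

theorem gdcst_iff_exists_isTree [Finite V] {ℓ u : G.edgeSet → ℕ}
    (h : ∀ e, ℓ e = u e ∧ u e = (dep D e).ncard) :
    GDCST D ℓ u ↔ ∃ Y : Set G.edgeSet, (edgeGraph Y).IsTree ∧ depSet D Y ⊆ Y := by
  constructor
  · rintro ⟨T, hTG, hT, hsat⟩
    obtain ⟨Y, rfl⟩ := exists_edgeGraph_eq hTG
    exact ⟨Y, hT, (satisfies_edgeGraph_iff h).1 hsat⟩
  · rintro ⟨Y, hY, hdep⟩
    exact ⟨edgeGraph Y, edgeGraph_le, hY, (satisfies_edgeGraph_iff h).2 hdep⟩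

theorem exists_isTree_iff (hD : ComponentsArePathsOfLengthLEOne D) :
    (∃ Y : Set G.edgeSet, (edgeGraph Y).IsTree ∧ depSet D Y ⊆ Y) ↔
      ∃ X ⊆ dependentEdges D, (edgeGraph (depSet D X)).IsAcyclic ∧
        (edgeGraph ((dependentEdges D)ᶜ ∪ X)).Connected := by
  constructor
  · rintro ⟨Y, hY, hdep⟩
    refine ⟨Y ∩ dependentEdges D, inter_subset_right, hY.isAcyclic.anti ?_,
      hY.connected.mono ?_⟩
    · rwa [edgeGraph_le_iff, depSet_inter_dependentEdges]
    · rw [edgeGraph_le_iff, union_inter_distrib_left, compl_union_self, inter_univ]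
      exact subset_union_right
  · rintro ⟨X, _, hac, hc⟩
    obtain ⟨T, hXT, hTX, hT⟩ := hc.exists_isTree_le_of_le_of_isAcyclic
      (edgeGraph_le_iff.2 ((depSet_subset_compl_dependentEdges hD).trans subset_union_left)) hac
    obtain ⟨Y, rfl⟩ := exists_edgeGraph_eq (hTX.trans edgeGraph_le)
    rw [edgeGraph_le_iff] at hXT hTX
    refine ⟨Y, hT, fun f hf => ?_⟩
    obtain ⟨e, he, hfe⟩ := mem_depSet.1 hf
    exact hXT (mem_depSet.2 ⟨e, (hTX he).resolve_left fun hn => hn ⟨f, hfe⟩, hfe⟩)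

/-- The ends of the dependency of an edge, for the edges that have just one. -/
noncomputable def depEnds (D : Digraph G.edgeSet) (e : G.edgeSet) : Sym2 V :=
  open Classical in if h : (dep D e).Nonempty then h.some else e

theorem depEnds_eq (hD : ComponentsArePathsOfLengthLEOne D) (hf : f ∈ dep D e) :
    depEnds D e = f := by
  have h : (dep D e).Nonempty := ⟨f, hf⟩
  rw [depEnds, dif_pos h, hD.adj_left_unique h.some_mem hf]

theorem image_depEnds (hD : ComponentsArePathsOfLengthLEOne D) (hX : X ⊆ dependentEdges D) :
    depEnds D '' X = Subtype.val '' depSet D X := by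
  ext z
  constructor
  · rintro ⟨e, he, rfl⟩
    obtain ⟨f, hf⟩ := hX he
    exact ⟨f, mem_depSet.2 ⟨e, he, hf⟩, (depEnds_eq hD hf).symm⟩
  · rintro ⟨f, hf, rfl⟩
    obtain ⟨e, he, hfe⟩ := mem_depSet.1 hf
    exact ⟨e, he, depEnds_eq hD hfe⟩

theorem injOn_depEnds (hD : ComponentsArePathsOfLengthLEOne D) :
    InjOn (depEnds D) (dependentEdges D) := by
  rintro e ⟨f, hf⟩ e' ⟨f', hf'⟩ h
  rw [depEnds_eq hD hf, depEnds_eq hD hf'] at h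
  obtain rfl := Subtype.ext h
  exact hD.adj_right_unique hf hf'

theorem isForest_depEnds_iff (hD : ComponentsArePathsOfLengthLEOne D)
    (hX : X ⊆ dependentEdges D) :
    IsForest (depEnds D) X ↔ (edgeGraph (depSet D X)).IsAcyclic := by
  rw [edgeGraph, ← image_depEnds hD hX]
  refine isForest_iff_isAcyclic ((injOn_depEnds hD).mono hX) fun e he => ?_
  obtain ⟨f, hf⟩ := hX he
  exact depEnds_eq hD hf ▸ G.not_isDiag_of_mem_edgeSet f.2

/-- The matroid `M₁`: the graphic matroid of the graph of the dependencies. -/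
noncomputable def depMatroid (D : Digraph G.edgeSet) : Matroid G.edgeSet :=
  graphicMatroid (depEnds D) (dependentEdges D)

/-- The matroid `M₂`: the graphic matroid of the multigraph in which the components of `G - S`
are contracted. -/
noncomputable def contractedMatroid (D : Digraph G.edgeSet) : Matroid G.edgeSet :=
  graphicMatroid (contractedEnds D) (dependentEdges D)

theorem depMatroid_indep_iff (hD : ComponentsArePathsOfLengthLEOne D) :
    (depMatroid D).Indep X ↔ X ⊆ dependentEdges D ∧ (edgeGraph (depSet D X)).IsAcyclic := by
  rw [depMatroid, graphicMatroid_indep_iff]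
  exact and_congr_right (isForest_depEnds_iff hD)

theorem mem_closure_depMatroid (hD : ComponentsArePathsOfLengthLEOne D) (hf : f ∈ dep D e)
    (hxy : (f : Sym2 V) = s(x, y)) :
    e ∈ (depMatroid D).closure X ↔ (edgeGraph (depSet D X)).Reachable x y := by
  rw [depMatroid, mem_closure_graphicMatroid ((depEnds_eq hD hf).trans hxy),
    and_iff_right ⟨f, hf⟩, image_depEnds hD inter_subset_right, depSet_inter_dependentEdges,
    edgeGraph]

theorem baseGraph_sup_fromEdgeSet :
    baseGraph D ⊔ fromEdgeSet (Subtype.val '' X) = edgeGraph ((dependentEdges D)ᶜ ∪ X) := by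
  rw [edgeGraph_union, baseGraph_eq_edgeGraph, edgeGraph, edgeGraph]

theorem image_contractedEnds :
    contractedEnds D '' X = Sym2.map (baseGraph D).connectedComponentMk '' (Subtype.val '' X) := by
  rw [image_image]
  rfl

theorem connected_contractedEnds_iff :
    (fromEdgeSet (contractedEnds D '' X)).Connected ↔
      (edgeGraph ((dependentEdges D)ᶜ ∪ X)).Connected := by
  rw [image_contractedEnds, connected_contract_iff, baseGraph_sup_fromEdgeSet]

theorem mem_closure_contractedMatroid (hxy : (e : Sym2 V) = s(x, y)) :
    e ∈ (contractedMatroid D).closure X ↔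
      e ∈ dependentEdges D ∧ (edgeGraph ((dependentEdges D)ᶜ ∪ X)).Reachable x y := by
  have hends : contractedEnds D e = s((baseGraph D).connectedComponentMk x,
      (baseGraph D).connectedComponentMk y) := by
    rw [contractedEnds, hxy, Sym2.map_mk]
  have hunion : (dependentEdges D)ᶜ ∪ X ∩ dependentEdges D = (dependentEdges D)ᶜ ∪ X := by
    rw [union_inter_distrib_left, compl_union_self, inter_univ]
  rw [contractedMatroid, mem_closure_graphicMatroid hends, image_contractedEnds, ← hunion,
    ← baseGraph_sup_fromEdgeSet]
  exact and_congr_right fun _ =>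
    ⟨reachable_of_reachable_contract, reachable_contract_of_reachable⟩

variable [Finite V] {ℓ u : G.edgeSet → ℕ}

theorem gdcst_iff_exists_connected (hD : ComponentsArePathsOfLengthLEOne D)
    (h : ∀ e, ℓ e = u e ∧ u e = (dep D e).ncard) :
    GDCST D ℓ u ↔ ∃ X, (depMatroid D).Indep X ∧
      (fromEdgeSet (contractedEnds D '' X)).Connected := by
  simp only [gdcst_iff_exists_isTree h, exists_isTree_iff hD, depMatroid_indep_iff hD,
    connected_contractedEnds_iff, and_assoc]

theorem gdcst_iff_exists_indep (hD : ComponentsArePathsOfLengthLEOne D)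
    (h : ∀ e, ℓ e = u e ∧ u e = (dep D e).ncard) :
    GDCST D ℓ u ↔ ∃ X, (depMatroid D).Indep X ∧ (contractedMatroid D).Indep X ∧
      X.ncard + 1 = Nat.card (baseGraph D).ConnectedComponent := by
  rw [gdcst_iff_exists_connected hD h]
  constructor
  · rintro ⟨X, hX, hc⟩
    obtain ⟨Y, hY⟩ := (contractedMatroid D).exists_isBasis X hX.subset_ground
    have hforest := (graphicMatroid_indep_iff.1 hY.indep).2
    exact ⟨Y, hX.subset hY.subset, hY.indep, hforest.connected_iff_ncard.1
      (connected_of_subset_closure_graphicMatroid hY.subset_closure hc)⟩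
  · rintro ⟨X, hX, hXc, hcard⟩
    exact ⟨X, hX, (graphicMatroid_indep_iff.1 hXc).2.connected_iff_ncard.2 hcard⟩

theorem gdcst_iff_connected_of_isMaxCommonIndep (hD : ComponentsArePathsOfLengthLEOne D)
    (h : ∀ e, ℓ e = u e ∧ u e = (dep D e).ncard)
    (hX : IsMaxCommonIndep (depMatroid D) (contractedMatroid D) X) :
    GDCST D ℓ u ↔ (edgeGraph ((dependentEdges D)ᶜ ∪ X)).Connected := by
  rw [← connected_contractedEnds_iff]
  refine ⟨fun hG => ?_, fun hc => (gdcst_iff_exists_connected hD h).2 ⟨X, hX.indep_left, hc⟩⟩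
  obtain ⟨J, hJ₁, hJ₂, hcard⟩ := (gdcst_iff_exists_indep hD h).1 hG
  obtain ⟨Y, hYX, hY⟩ := exists_subset_encard_eq (hX.encard_le J hJ₁ hJ₂)
  have hYforest := (graphicMatroid_indep_iff.1 (hX.indep_right.subset hYX)).2
  have hYc := hYforest.connected_iff_ncard.2 (by rwa [ncard, hY])
  exact hYc.mono (fromEdgeSet_mono (image_mono hYX))

end Feasibility

/-! ### Instances as arrays -/

section Arrays

theorem toArray_of_lt {k b : ℕ} (f : Fin k → Fin b) {i : ℕ} (h : i < k) :
    toArray f i = f ⟨i, h⟩ := dif_pos h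

@[simp] theorem toArray_val {k b : ℕ} (f : Fin k → Fin b) (i : Fin k) : toArray f i = f i :=
  toArray_of_lt f i.2

namespace Instance

open Set SimpleGraph

variable (I : Instance)

/-- The position of an edge in the list of edges. -/
def pos : I.G.edgeSet ↪ ℕ := I.edge.symm.toEmbedding.trans Fin.valEmbedding

/-- The relation between the ends of the edges whose positions belong to `A`. -/
def EdgeAdj (A : Set ℕ) (u v : ℕ) : Prop :=
  ∃ i < I.m, i ∈ A ∧ (toArray I.fst i = u ∧ toArray I.snd i = v ∨
    toArray I.fst i = v ∧ toArray I.snd i = u)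

/-- The ends of the edge at the position `j` are joined by a path along the edges whose positions
belong to `A`. -/
def EndsJoined (A : Set ℕ) (j : ℕ) : Prop :=
  HasPath (I.EdgeAdj A) (· = toArray I.fst j) (· = toArray I.snd j) (Iio I.size)

/-- The positions of the edges of `S`. -/
def dependentPos : Set ℕ := {i | ∃ k < I.r, toArray I.head k = i}

/-- The positions of the dependencies of the edges whose positions belong to `A`. -/
def depPos (A : Set ℕ) : Set ℕ := {i | ∃ k < I.r, toArray I.tail k = i ∧ toArray I.head k ∈ A}

/-- The matroid `M₁`, on the positions of the edges. -/
noncomputable def posDepMatroid : Matroid ℕ := (depMatroid I.D).mapEmbedding I.pos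

/-- The matroid `M₂`, on the positions of the edges. -/
noncomputable def posContractedMatroid : Matroid ℕ :=
  (contractedMatroid I.D).mapEmbedding I.pos

/-- The positions of a common independent set of the two matroids of the largest size. -/
noncomputable def maxCommonPos : Set ℕ :=
  maxCommonIndep I.posDepMatroid I.posContractedMatroid I.size

variable {I} {A : Set ℕ} {e f : I.G.edgeSet}

theorem pos_edge (i : Fin I.m) : I.pos (I.edge i) = i := by simp [pos]

theorem pos_lt (e : I.G.edgeSet) : I.pos e < I.m := (I.edge.symm e).2

theorem exists_pos_eq {i : ℕ} (hi : i < I.m) : ∃ e, I.pos e = i := ⟨I.edge ⟨i, hi⟩, pos_edge _⟩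

theorem exists_ends_eq (e : I.G.edgeSet) : ∃ u v : Fin I.n, (e : Sym2 (Fin I.n)) = s(u, v) ∧
    toArray I.fst (I.pos e) = u ∧ toArray I.snd (I.pos e) = v := by
  obtain ⟨i, rfl⟩ := I.edge.surjective e
  exact ⟨_, _, I.edge_eq i, by rw [pos_edge, toArray_val], by rw [pos_edge, toArray_val]⟩

theorem exists_arc_of_mem_dep (h : f ∈ dep I.D e) :
    ∃ k < I.r, toArray I.tail k = I.pos f ∧ toArray I.head k = I.pos e := by
  obtain ⟨i, rfl⟩ := I.edge.surjective e
  obtain ⟨j, rfl⟩ := I.edge.surjective f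
  obtain ⟨k, hj, hi⟩ := (I.adj_iff j i).1 h
  exact ⟨k, k.2, by rw [toArray_val, hj, pos_edge], by rw [toArray_val, hi, pos_edge]⟩

theorem exists_mem_dep_of_lt {k : ℕ} (hk : k < I.r) : ∃ e f, f ∈ dep I.D e ∧
    toArray I.tail k = I.pos f ∧ toArray I.head k = I.pos e :=
  ⟨I.edge (I.head ⟨k, hk⟩), I.edge (I.tail ⟨k, hk⟩), (I.adj_iff _ _).2 ⟨⟨k, hk⟩, rfl, rfl⟩,
    by rw [toArray_of_lt _ hk, pos_edge], by rw [toArray_of_lt _ hk, pos_edge]⟩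

theorem image_pos_dependentEdges : I.pos '' dependentEdges I.D = I.dependentPos := by
  ext i
  constructor
  · rintro ⟨e, ⟨f, hf⟩, rfl⟩
    obtain ⟨k, hk, -, he⟩ := exists_arc_of_mem_dep hf
    exact ⟨k, hk, he⟩
  · rintro ⟨k, hk, rfl⟩
    obtain ⟨e, f, hf, -, he⟩ := exists_mem_dep_of_lt hk
    exact ⟨e, ⟨f, hf⟩, he.symm⟩

theorem preimage_pos_dependentPos : I.pos ⁻¹' I.dependentPos = dependentEdges I.D := by
  rw [← image_pos_dependentEdges, preimage_image_eq _ I.pos.injective]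

theorem preimage_pos_depPos : I.pos ⁻¹' I.depPos A = depSet I.D (I.pos ⁻¹' A) := by
  ext f
  rw [mem_depSet]
  constructor
  · rintro ⟨k, hk, hf, hA⟩
    obtain ⟨e, f', h, hf', he⟩ := exists_mem_dep_of_lt hk
    obtain rfl := I.pos.injective (hf.symm.trans hf')
    exact ⟨e, mem_preimage.2 (he ▸ hA), h⟩
  · rintro ⟨e, hA, h⟩
    obtain ⟨k, hk, hf, he⟩ := exists_arc_of_mem_dep h
    exact ⟨k, hk, hf, he ▸ hA⟩

theorem edgeAdj_iff {u v : Fin I.n} :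
    I.EdgeAdj A u v ↔ ∃ e : I.G.edgeSet, I.pos e ∈ A ∧ (e : Sym2 (Fin I.n)) = s(u, v) := by
  have hends : ∀ e : I.G.edgeSet, (toArray I.fst (I.pos e) = u ∧ toArray I.snd (I.pos e) = v ∨
      toArray I.fst (I.pos e) = v ∧ toArray I.snd (I.pos e) = u) ↔
      (e : Sym2 (Fin I.n)) = s(u, v) := fun e => by
    obtain ⟨a, b, he, ha, hb⟩ := exists_ends_eq e
    rw [he, ha, hb, Sym2.eq_iff, Fin.val_inj, Fin.val_inj, Fin.val_inj, Fin.val_inj]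
  constructor
  · rintro ⟨i, hi, hA, h⟩
    obtain ⟨e, rfl⟩ := exists_pos_eq hi
    exact ⟨e, hA, (hends e).1 h⟩
  · rintro ⟨e, hA, h⟩
    exact ⟨I.pos e, pos_lt e, hA, (hends e).2 h⟩

theorem EdgeAdj.lt_n {u v : ℕ} (h : I.EdgeAdj A u v) : u < I.n := by
  obtain ⟨i, hi, -, h⟩ := h
  rw [toArray_of_lt _ hi, toArray_of_lt _ hi] at h
  rcases h with ⟨rfl, -⟩ | ⟨-, rfl⟩ <;> exact Fin.is_lt _

theorem hasPath_edgeAdj_iff {u v : Fin I.n} :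
    HasPath (I.EdgeAdj A) (· = (u : ℕ)) (· = (v : ℕ)) (Iio I.size) ↔
      (edgeGraph (I.pos ⁻¹' A)).Reachable u v := by
  have hsize : ∀ w : Fin I.n, (w : ℕ) ∈ Iio I.size := fun w =>
    w.2.trans_le (by rw [size, add_assoc]; exact Nat.le_add_right ..)
  rw [edgeGraph, reachable_fromEdgeSet_eq_reflTransGen_toRel]
  constructor
  · rintro ⟨_, -, w, -, rfl, hw, h⟩
    induction h generalizing v with
    | refl => rw [Fin.ext hw]
    | tail _ h ih =>
      subst hw
      exact (ih (v := ⟨_, h.2.2.lt_n⟩) rfl).tail (edgeAdj_iff.1 h.2.2)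
  · refine fun h => ⟨u, hsize u, v, hsize v, rfl, rfl, ?_⟩
    induction h with
    | refl => exact .refl
    | tail _ h ih => exact ih.tail ⟨hsize _, hsize _, edgeAdj_iff.2 h⟩

theorem endsJoined_pos_iff {x y : Fin I.n} (hxy : (e : Sym2 (Fin I.n)) = s(x, y)) :
    I.EndsJoined A (I.pos e) ↔ (edgeGraph (I.pos ⁻¹' A)).Reachable x y := by
  obtain ⟨a, b, he, ha, hb⟩ := exists_ends_eq e
  rw [EndsJoined, ha, hb, hasPath_edgeAdj_iff]
  rcases Sym2.eq_iff.1 (he.symm.trans hxy) with ⟨rfl, rfl⟩ | ⟨rfl, rfl⟩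
  · rfl
  · exact reachable_comm

theorem ground_posDepMatroid : I.posDepMatroid.E = I.dependentPos := image_pos_dependentEdges

theorem ground_posContractedMatroid : I.posContractedMatroid.E = I.dependentPos :=
  image_pos_dependentEdges

theorem dependentPos_subset : I.dependentPos ⊆ Iio I.size := by
  rw [← image_pos_dependentEdges]
  rintro _ ⟨e, -, rfl⟩
  have := pos_lt e
  rw [mem_Iio, size]
  omega

theorem mem_closure_posDepMatroid (hD : ComponentsArePathsOfLengthLEOne I.D) {i : ℕ} :
    i ∈ I.posDepMatroid.closure A ↔
      ∃ k < I.r, toArray I.head k = i ∧ I.EndsJoined (I.depPos A) (toArray I.tail k) := by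
  have hjoined : ∀ {e f : I.G.edgeSet}, f ∈ dep I.D e →
      (e ∈ (depMatroid I.D).closure (I.pos ⁻¹' A) ↔ I.EndsJoined (I.depPos A) (I.pos f)) := by
    intro e f hf
    induction hxy : (f : Sym2 (Fin I.n)) with | h x y =>
    rw [mem_closure_depMatroid hD hf hxy, endsJoined_pos_iff hxy, preimage_pos_depPos]
  rw [posDepMatroid, Matroid.mapEmbedding, Matroid.map_closure_eq]
  constructor
  · rintro ⟨e, he, rfl⟩
    obtain ⟨f, hf⟩ : e ∈ dependentEdges I.D := Matroid.closure_subset_ground _ _ he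
    obtain ⟨k, hk, htail, hhead⟩ := exists_arc_of_mem_dep hf
    exact ⟨k, hk, hhead, htail ▸ (hjoined hf).1 he⟩
  · rintro ⟨k, hk, rfl, h⟩
    obtain ⟨e, f, hf, htail, hhead⟩ := exists_mem_dep_of_lt hk
    exact ⟨e, (hjoined hf).2 (htail ▸ h), hhead.symm⟩

theorem mem_closure_posContractedMatroid {i : ℕ} :
    i ∈ I.posContractedMatroid.closure A ↔
      i ∈ I.dependentPos ∧ I.EndsJoined (I.dependentPosᶜ ∪ A) i := by
  have hjoined : ∀ e : I.G.edgeSet, e ∈ (contractedMatroid I.D).closure (I.pos ⁻¹' A) ↔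
      e ∈ dependentEdges I.D ∧ I.EndsJoined (I.dependentPosᶜ ∪ A) (I.pos e) := by
    intro e
    induction hxy : (e : Sym2 (Fin I.n)) with | h x y =>
    rw [mem_closure_contractedMatroid hxy, endsJoined_pos_iff hxy, preimage_union, preimage_compl,
      preimage_pos_dependentPos]
  rw [posContractedMatroid, Matroid.mapEmbedding, Matroid.map_closure_eq,
    ← image_pos_dependentEdges]
  constructor
  · rintro ⟨e, he, rfl⟩
    exact ⟨mem_image_of_mem _ ((hjoined e).1 he).1, image_pos_dependentEdges ▸ ((hjoined e).1 he).2⟩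
  · rintro ⟨⟨e, he, rfl⟩, h⟩
    exact ⟨e, (hjoined e).2 ⟨he, image_pos_dependentEdges ▸ h⟩, rfl⟩

theorem gdcst_iff_forall_hasPath {ℓ u : I.G.edgeSet → ℕ}
    (hD : ComponentsArePathsOfLengthLEOne I.D) (h : ∀ e, ℓ e = u e ∧ u e = (dep I.D e).ncard) :
    GDCST I.D ℓ u ↔ 0 < I.n ∧ ∀ v < I.n,
      HasPath (I.EdgeAdj (I.dependentPosᶜ ∪ I.maxCommonPos)) (· = 0) (· = v) (Iio I.size) := by
  have hmax : IsMaxCommonIndep I.posDepMatroid I.posContractedMatroid I.maxCommonPos :=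
    isMaxCommonIndep_maxCommonIndep (ground_posDepMatroid.trans_subset dependentPos_subset)
  rw [gdcst_iff_connected_of_isMaxCommonIndep hD h hmax.of_mapEmbedding,
    ← preimage_pos_dependentPos, ← preimage_compl, ← preimage_union]
  constructor
  · intro hc
    obtain ⟨w⟩ := hc.nonempty
    exact ⟨w.pos, fun v hv => (hasPath_edgeAdj_iff (u := ⟨0, w.pos⟩) (v := ⟨v, hv⟩)).2
      (hc.preconnected _ _)⟩
  · rintro ⟨hn, hpath⟩
    exact (connected_iff_exists_forall_reachable _).2
      ⟨⟨0, hn⟩, fun v => hasPath_edgeAdj_iff.1 (hpath v v.2)⟩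

end Instance

end Arrays

/-! ### Deciding feasibility in polynomial time -/

section InstanceRep

open Set

variable {ι : Type} {F : ι → Instance}

/-- The instances `F i` in the way in which they are presented to the machine, apart from the
registers: the size is kept in register `0`, and `m`, `r`, `n` in the registers `1`, `2`, `3`. -/
def instanceRep (F : ι → Instance) : Rep ι where
  Holds i s := (s.reg 0 = (F i).size ∧ s.reg 1 = (F i).m ∧ s.reg 2 = (F i).r ∧ s.reg 3 = (F i).n) ∧
    ∀ k < 4, s.arr k = (F i).input.arr k
  d := 4
  a := 4
  N i := (F i).size
  d_pos := by omega
  reg_zero h := h.1.1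
  congr h h' := by
    refine ⟨?_, fun k hk => (h'.arr k hk).trans (h.2 k hk)⟩
    rw [h'.reg 0 (by omega), h'.reg 1 (by omega), h'.reg 2 (by omega), h'.reg 3 (by omega)]
    exact h.1

theorem solvableInPolyTime_of_polyDec {φ : ι → Prop} (h : PolyDec (instanceRep F) φ) :
    SolvableInPolyTime (fun i => (F i).input) (fun i => (F i).size) φ := by
  obtain ⟨P, b, hP⟩ := h 4 le_rfl 4 le_rfl
  let prog : Prog := .seq (.add 3 0 4) (.seq (.add 0 0 1) (.seq (.add 0 0 2)
    (.seq P (.seq (.const 0 0) (.add 0 0 4)))))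
  refine ⟨prog, b + 5, fun i => ?_⟩
  set s₀ := (((F i).input.setReg 3 (F i).n).setReg 0 ((F i).n + (F i).m)).setReg 0 (F i).size
  have hs₀ : (instanceRep F).Holds i s₀ := ⟨⟨rfl, rfl, rfl, rfl⟩, fun _ _ => rfl⟩
  have hP₀ : Runs P s₀ (b.eval (F i).size) fun s => s.reg 4 = truthValue (φ i) :=
    (hP i s₀ hs₀).mono le_rfl fun s hs => hs.2
  have hrun : Runs prog (F i).input (1 + (1 + (1 + (b.eval (F i).size + (1 + 1)))))
      fun s => s.reg 0 = truthValue (φ i) :=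
    .seq <| .add <| .seq <| .add <| .seq <| .add <| .seq <| hP₀.mono le_rfl fun s hs =>
      .seq <| .const <| .add <| (zero_add (s.reg 4)).trans hs
  obtain ⟨s, t, he, ht, hs⟩ := hrun
  have htime : (b + 5).eval (F i).size = b.eval (F i).size + 5 := by
    rw [Polynomial.eval_add, Polynomial.eval_ofNat]
  refine ⟨s, t, he, ht.trans (le_trans (by omega) htime.ge), ?_⟩
  rw [hs, ← pos_iff_ne_zero, truthValue_pos]

theorem polyFun_m : PolyFun (instanceRep F) fun i => (F i).m :=
  .of_reg (r := 1) (show 1 < 4 by omega) fun _ _ h => h.1.2.1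

theorem polyFun_r : PolyFun (instanceRep F) fun i => (F i).r :=
  .of_reg (r := 2) (show 2 < 4 by omega) fun _ _ h => h.1.2.2.1

theorem polyFun_n : PolyFun (instanceRep F) fun i => (F i).n :=
  .of_reg (r := 3) (show 3 < 4 by omega) fun _ _ h => h.1.2.2.2

theorem polyMap_fst : PolyMap (instanceRep F) fun i => toArray (F i).fst :=
  .of_arr (k := 0) fun _ _ h => h.2 0 (by decide)

theorem polyMap_snd : PolyMap (instanceRep F) fun i => toArray (F i).snd :=
  .of_arr (k := 1) fun _ _ h => h.2 1 (by decide)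

theorem polyMap_tail : PolyMap (instanceRep F) fun i => toArray (F i).tail :=
  .of_arr (k := 2) fun _ _ h => h.2 2 (by decide)

theorem polyMap_head : PolyMap (instanceRep F) fun i => toArray (F i).head :=
  .of_arr (k := 3) fun _ _ h => h.2 3 (by decide)

theorem Instance.n_le_size (I : Instance) : I.n ≤ I.size := by rw [size]; omega

theorem Instance.m_le_size (I : Instance) : I.m ≤ I.size := by rw [size]; omega

theorem Instance.r_le_size (I : Instance) : I.r ≤ I.size := by rw [size]; omega

variable {Γ : Type} {R : Rep Γ} {g : Γ → ι} {A : Γ → Set ℕ} {x y : Γ → ℕ}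

theorem PolyPred.exists_lt_r {ρ : Γ → ℕ → Prop} (hR : Extends R (instanceRep F) g)
    (hρ : PolyPred R ρ) : PolyDec R fun γ => ∃ k < (F (g γ)).r, ρ γ k :=
  hρ.exists_lt (polyFun_r.comap hR) fun γ => hR.N_eq γ ▸ (F (g γ)).r_le_size

theorem polyPred_mem_dependentPos (hR : Extends R (instanceRep F) g) :
    PolyPred R fun γ i => i ∈ (F (g γ)).dependentPos := fun x _ =>
  PolyPred.exists_lt_r (hR.withReg x) fun k _ =>
    ((polyMap_head.comap ((hR.withReg x).withReg k)).app polyFun_snd).eq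
      (polyFun_snd.comap ((Extends.refl _).withReg k))

theorem polyPred_mem_depPos (hR : Extends R (instanceRep F) g)
    (hA : PolyPred R fun γ i => i ∈ A γ) :
    PolyPred R fun γ i => i ∈ (F (g γ)).depPos (A γ) := fun x _ =>
  PolyPred.exists_lt_r (hR.withReg x) fun k _ =>
    have hRk := (hR.withReg x).withReg k
    (((polyMap_tail.comap hRk).app polyFun_snd).eq
      (polyFun_snd.comap ((Extends.refl _).withReg k))).and
      ((hA.comap (((Extends.refl R).withReg x).withReg k)).app
        ((polyMap_head.comap hRk).app polyFun_snd))

theorem polyPred_mem_compl_dependentPos_union (hR : Extends R (instanceRep F) g)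
    (hA : PolyPred R fun γ i => i ∈ A γ) :
    PolyPred R fun γ i => i ∈ (F (g γ)).dependentPosᶜ ∪ A γ := fun x hx =>
  (polyPred_mem_dependentPos hR x hx).not.or (hA x hx)

theorem polyRel_edgeAdj (hR : Extends R (instanceRep F) g)
    (hA : PolyPred R fun γ i => i ∈ A γ) : PolyRel R fun γ => (F (g γ)).EdgeAdj (A γ) := by
  intro x _ y _
  have hR' := (hR.withReg x).withReg y
  refine PolyPred.exists_lt (fun i _ => ?_) (polyFun_m.comap hR') fun p =>
    hR'.N_eq p ▸ (F (g p.1.1)).m_le_size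
  have hfst := (polyMap_fst.comap (hR'.withReg i)).app polyFun_snd
  have hsnd := (polyMap_snd.comap (hR'.withReg i)).app polyFun_snd
  have hu := (polyFun_snd (R := R) (r := x)).comap (((Extends.refl _).withReg y).withReg i)
  have hv := (polyFun_snd (R := R.withReg x) (r := y)).comap ((Extends.refl _).withReg i)
  exact ((hA.comap ((((Extends.refl R).withReg x).withReg y).withReg i)).app polyFun_snd).and
    (((hfst.eq hu).and (hsnd.eq hv)).or ((hfst.eq hv).and (hsnd.eq hu)))

theorem polyDec_hasPath_edgeAdj (hR : Extends R (instanceRep F) g)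
    (hA : PolyPred R fun γ i => i ∈ A γ) (hx : PolyFun R x) (hy : PolyFun R y) :
    PolyDec R fun γ =>
      HasPath ((F (g γ)).EdgeAdj (A γ)) (· = x γ) (· = y γ) (Iio (F (g γ)).size) := by
  have heq : ∀ {z : Γ → ℕ}, PolyFun R z → PolyPred R fun γ i => i = z γ := fun hz r _ =>
    polyFun_snd.eq (hz.comap ((Extends.refl R).withReg r))
  refine polyDec_hasPath (polyRel_edgeAdj hR hA) (heq hx) (heq hy) (fun r _ => ?_)
    fun γ => (congrArg Iio (hR.N_eq γ)).superset
  exact polyFun_snd.lt (polyFun_bound.comap (hR.withReg r))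

theorem polyPred_endsJoined (hR : Extends R (instanceRep F) g)
    (hA : PolyPred R fun γ i => i ∈ A γ) :
    PolyPred R fun γ => (F (g γ)).EndsJoined (A γ) := fun r _ =>
  polyDec_hasPath_edgeAdj (hR.withReg r) (hA.comap ((Extends.refl R).withReg r))
    ((polyMap_fst.comap (hR.withReg r)).app polyFun_snd)
    ((polyMap_snd.comap (hR.withReg r)).app polyFun_snd)

theorem polyMatroid_posDepMatroid (hD : ∀ i, ComponentsArePathsOfLengthLEOne (F i).D) :
    PolyMatroid (instanceRep F) fun i => (F i).posDepMatroid where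
  ground_subset i := by
    rw [Instance.ground_posDepMatroid]
    exact Instance.dependentPos_subset
  mem_ground := by
    simpa only [Instance.ground_posDepMatroid] using polyPred_mem_dependentPos (Extends.refl _)
  mem_closure_snd k _ := by
    have hR := (Extends.refl (instanceRep F)).withArr k
    simp only [Instance.mem_closure_posDepMatroid (hD _)]
    refine fun x _ => PolyPred.exists_lt_r (hR.withReg x) fun j _ => ?_
    have hRj := (hR.withReg x).withReg j
    refine (((polyMap_head.comap hRj).app polyFun_snd).eq
      (polyFun_snd.comap ((Extends.refl _).withReg j))).and ?_
    exact (polyPred_endsJoined hRj (polyPred_mem_depPos hRj (polyPred_mem_snd.comap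
      (((Extends.refl _).withReg x).withReg j)))).app ((polyMap_tail.comap hRj).app polyFun_snd)

theorem polyMatroid_posContractedMatroid :
    PolyMatroid (instanceRep F) fun i => (F i).posContractedMatroid where
  ground_subset i := by
    rw [Instance.ground_posContractedMatroid]
    exact Instance.dependentPos_subset
  mem_ground := by
    simpa only [Instance.ground_posContractedMatroid] using
      polyPred_mem_dependentPos (Extends.refl _)
  mem_closure_snd k _ := by
    have hR := (Extends.refl (instanceRep F)).withArr k
    simp only [Instance.mem_closure_posContractedMatroid]
    exact fun x hx => (polyPred_mem_dependentPos hR x hx).and (polyPred_endsJoined hR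
      (polyPred_mem_compl_dependentPos_union hR polyPred_mem_snd) x hx)

theorem polyDec_gdcst {ℓ u : ∀ i, (F i).G.edgeSet → ℕ}
    (hD : ∀ i, ComponentsArePathsOfLengthLEOne (F i).D)
    (h : ∀ i e, ℓ i e = u i e ∧ u i e = (dep (F i).D e).ncard) :
    PolyDec (instanceRep F) fun i => GDCST (F i).D (ℓ i) (u i) := by
  have hmax : PolyPred (instanceRep F) fun i j => j ∈ (F i).maxCommonPos :=
    (polyMatroid_posDepMatroid hD).mem_maxCommonIndep polyMatroid_posContractedMatroid
  have hpath : PolyPred (instanceRep F) fun i v => HasPath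
      ((F i).EdgeAdj ((F i).dependentPosᶜ ∪ (F i).maxCommonPos)) (· = 0) (· = v)
      (Iio (F i).size) := fun r _ =>
    have hR := (Extends.refl (instanceRep F)).withReg r
    polyDec_hasPath_edgeAdj hR (polyPred_mem_compl_dependentPos_union hR (hmax.comap hR))
      (polyFun_const 0) polyFun_snd
  exact (polyFun_n.pos.and (hpath.forall_lt polyFun_n fun i => (F i).n_le_size)).congr fun i =>
    (Instance.gdcst_iff_forall_hasPath (hD i) (h i)).symm

end InstanceRep

end DCST

theorem mainTheorem7 :
    DCST.SolvableInPolyTime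
      (ι := {I : DCST.Instance // DCST.ComponentsArePathsOfLengthLEOne I.D})
      (fun I => I.1.input) (fun I => I.1.size)
      (fun I => DCST.GDCST I.1.D
        (fun e => (DCST.dep I.1.D e).ncard) (fun e => (DCST.dep I.1.D e).ncard)) ∧
    ∀ (V : Type*) [Finite V] (G : SimpleGraph V) (D : Digraph G.edgeSet) (ℓ u : G.edgeSet → ℕ),
      DCST.ComponentsArePathsOfLengthLEOne D →
      (∀ e, ℓ e = u e ∧ u e = (DCST.dep D e).ncard) →
      ∃ M₁ M₂ : Matroid G.edgeSet,
        M₁.E = DCST.dependentEdges D ∧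
        (∀ X : Set G.edgeSet, M₁.Indep X ↔ X ⊆ DCST.dependentEdges D ∧
          (SimpleGraph.fromEdgeSet (Subtype.val '' DCST.depSet D X)).IsAcyclic) ∧
        (∃ ends : G.edgeSet → Sym2 V,
          (∀ e, ∀ f ∈ DCST.dep D e, ends e = f) ∧ DCST.IsGraphicMatroidOf M₁ ends) ∧
        M₂.E = DCST.dependentEdges D ∧
        DCST.IsGraphicMatroidOf M₂ (DCST.contractedEnds D) ∧
        (DCST.GDCST D ℓ u ↔
          ∃ X : Set G.edgeSet, M₁.Indep X ∧ M₂.Indep X ∧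
            X.ncard + 1 = Nat.card (DCST.baseGraph D).ConnectedComponent) := by
  refine ⟨DCST.solvableInPolyTime_of_polyDec
    (DCST.polyDec_gdcst (fun I => I.2) fun _ _ => ⟨rfl, rfl⟩), ?_⟩
  intro V _ G D ℓ u hD h
  refine ⟨DCST.depMatroid D, DCST.contractedMatroid D, DCST.graphicMatroid_ground, ?_, ?_,
    DCST.graphicMatroid_ground, DCST.isGraphicMatroidOf_graphicMatroid,
    DCST.gdcst_iff_exists_indep hD h⟩
  · exact fun X => DCST.depMatroid_indep_iff hD
  · exact ⟨DCST.depEnds D, fun e f hf => DCST.depEnds_eq hD hf,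
      DCST.isGraphicMatroidOf_graphicMatroid⟩
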